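/- Let $X$ be a real or complex Banach space; "$c_0\not\subset X$" means that no linear subspace of $X$ is isomorphic to the Banach space $c_0$. Write $\Delta_h f(t)=f(t+h)-f(t)$, $Pf(t)=\int_0^t f(s)\,ds$, $M_hf(t)=\frac1h\int_0^h f(t+s)\,ds$. For a Banach space $Y$, a continuous $f:\mathbb R\to Y$ is *recurrent*, $f\in REC(\mathbb R,Y)$, if for each compact $K\subset\mathbb R$ and each $\varepsilon>0$ there is a compact $L\subset\mathbb R$ with $\{\tau:\ \|f(t+\tau)-f(t)\|\le\varepsilon\ \text{for all } t\in K\}+L=\mathbb R$. Let $C_b,C_u,C_{rc},C_{rwc}$ be the sets of functions $\mathbb R\to X$ which are, respectively, bounded and continuous, uniformly continuous, continuous with relatively compact range, continuous with relatively weakly compact range; $C_{urc}=C_u\cap C_{rc}$, $C_{urwc}=C_u\cap C_{rwc}$. Let $C_{b,wscp}$ be the set of $f\in C_b$ such that every weakly Cauchy sequence in $f(\mathbb R)$ converges weakly to an element of $X$. For $xy\in\{b,u,rwc,rc,urwc,urc\}$ put $REC_{xy}=REC(\mathbb R,X)\cap C_{xy}$; for the empty index, $REC_{xy}=REC(\mathbb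 R,X)$. A set $U$ of functions $\mathbb R\to X$ is said to satisfy (3.2) if $(f_1,\dots,f_n)\in REC(\mathbb R,X^n)$ for all $n\ge1$ and $f_1,\dots,f_n\in U$. For $\emptyset\ne V\subset REC_{xy}$ satisfying (3.2), $rec_{xy}V$ denotes a maximal element (with respect to inclusion) of the family of all $U$ with $V\subset U\subset REC_{xy}$ that satisfy (3.2) (for the empty index: $rec\,V$). For sets $\mathcal A,U$ of functions $\mathbb R\to X$, consider the conditions: - $(L_U)$: if $F\in U$ and $\Delta_hF\in\mathcal A$ for all $h>0$, then $F\in\mathcal A$. - $(P_U)$: if $f\in\mathcal A$ and $Pf\in U$, then $Pf\in\mathcal A$. - $(\Delta)$: if $f\in L^1_{loc}(\mathbb R,X)$ and $\Delta_hf\in\mathcal A$ for all $h>0$, then $f-M_kf\in\mathcal A$ for all $k>0$. **Corollary 4.9.** Let $xy$ be empty or one of $b,u,rwc,rc,urwc,urc$, let $\emptyset\neq V\subset REC_{xy}$ satisfy (3.2), and let $\mathcal A=rec_{xy}V$ be any such maximal element. Then: 1. $\mathcal A$ satisfies $(L_U)$ and $(P_U)$ in each of the cases (i) $U=C_b$ and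 $c_0\not\subset X$; (ii) $U=C_{b,wscp}$. 2. If $xy$ is not empty, and if moreover $c_0\not\subset X$ in the cases $xy=b$ and $xy=rwc$, then $\mathcal A$ satisfies $(\Delta)$. -/

import Mathlib

open Set Filter Topology MeasureTheory
open scoped Pointwise ZeroAtInfty

noncomputable section

namespace RecFun

section Group

variable {G : Type*} [TopologicalSpace G] [AddCommGroup G]

/-- `E ⊆ G` is relatively dense: `E + L = G` for some compact `L`. -/
def RelDense (E : Set G) : Prop :=
  ∃ L : Set G, IsCompact L ∧ E + L = univ

/-- The set `E(f, ε, K)` of `ε`-`K`-periods of `f`. -/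
def periods {Y : Type*} [NormedAddCommGroup Y] (f : G → Y) (ε : ℝ) (K : Set G) : Set G :=
  {τ | ∀ t ∈ K, ‖f (t + τ) - f t‖ ≤ ε}

/-- Recurrent functions `G → Y`. -/
def IsRecurrent {Y : Type*} [NormedAddCommGroup Y] (f : G → Y) : Prop :=
  Continuous f ∧ ∀ K : Set G, IsCompact K → ∀ ε : ℝ, 0 < ε → RelDense (periods f ε K)

/-- Any finitely many members `f₁, …, fₙ` of `U` (repetitions allowed) are jointly recurrent:
`(f₁, …, fₙ) : G → Xⁿ` is recurrent. -/
def JointlyRecurrent {X : Type*} [NormedAddCommGroup X] (U : Set (G → X)) : Prop :=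
  ∀ (n : ℕ) (f : Fin n → G → X), 1 ≤ n → (∀ i, f i ∈ U) →
    IsRecurrent (fun (t : G) (i : Fin n) => f i t)

end Group

section Spaces

variable (𝕜 : Type*) [RCLike 𝕜] (X : Type*) [NormedAddCommGroup X] [NormedSpace 𝕜 X]

/-- `c₀ ⊂ X`: some linear subspace of `X` is isomorphic to the Banach space `c₀`
of null sequences of scalars. -/
def ContainsC0 : Prop :=
  ∃ S : Submodule 𝕜 X, Nonempty (C₀(ℕ, 𝕜) ≃L[𝕜] S)

variable {X}

/-- Relatively weakly compact subsets of `X`. -/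
def RelWeaklyCompact (M : Set X) : Prop :=
  IsCompact (closure (toWeakSpace 𝕜 X '' M))

/-- Relatively weakly sequentially complete subsets of `X`: every weakly Cauchy sequence in `M`
converges weakly to some element of `X`. -/
def RelWeaklySeqComplete (M : Set X) : Prop :=
  ∀ x : ℕ → X, (∀ n, x n ∈ M) →
    (∀ φ : StrongDual 𝕜 X, CauchySeq (fun n => φ (x n))) →
    ∃ a : X, ∀ φ : StrongDual 𝕜 X, Tendsto (fun n => φ (x n)) atTop (𝓝 (φ a))

variable (X)

/-- `C_b(ℝ, X)`: bounded continuous functions. -/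
def Cb : Set (ℝ → X) := {f | Continuous f ∧ Bornology.IsBounded (range f)}

/-- `C_u(ℝ, X)`: uniformly continuous functions. -/
def Cu : Set (ℝ → X) := {f | UniformContinuous f}

/-- `C_rc(ℝ, X)`: continuous functions with relatively compact range. -/
def Crc : Set (ℝ → X) := {f | Continuous f ∧ IsCompact (closure (range f))}

/-- `C_rwc(ℝ, X)`: continuous functions with relatively weakly compact range. -/
def Crwc : Set (ℝ → X) := {f | Continuous f ∧ RelWeaklyCompact 𝕜 (range f)}

/-- `C_{b,wscp}(ℝ, X)`: bounded continuous functions with relatively weakly sequentially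
complete range. -/
def Cbwscp : Set (ℝ → X) := {f | f ∈ Cb X ∧ RelWeaklySeqComplete 𝕜 (range f)}

/-- The possible values of the index `xy` in `REC_xy`; `none` stands for no index. -/
inductive Idx
  | none | b | u | rwc | rc | urwc | urc

/-- `C_xy(ℝ, X)`. -/
def Cxy : Idx → Set (ℝ → X)
  | .none => {f | Continuous f}
  | .b => Cb X
  | .u => Cu X
  | .rwc => Crwc 𝕜 X
  | .rc => Crc X
  | .urwc => Cu X ∩ Crwc 𝕜 X
  | .urc => Cu X ∩ Crc X

/-- `REC_xy(ℝ, X) = REC(ℝ, X) ∩ C_xy(ℝ, X)`. -/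
def REC (xy : Idx) : Set (ℝ → X) := {f | IsRecurrent f} ∩ Cxy 𝕜 X xy

variable {X}

/-- `A` is a possible value of `rec_xy V`: a maximal element, with respect to inclusion, of the
family of all jointly recurrent `U` with `V ⊆ U ⊆ REC_xy(ℝ, X)`. -/
def IsRecClass (xy : Idx) (V A : Set (ℝ → X)) : Prop :=
  Maximal (fun U : Set (ℝ → X) => U ⊆ REC 𝕜 X xy ∧ V ⊆ U ∧ JointlyRecurrent U) A

/-- By Zorn's lemma such maximal elements exist. -/
theorem exists_isRecClass (xy : Idx) (V : Set (ℝ → X)) (hV : V ⊆ REC 𝕜 X xy)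
    (hV2 : JointlyRecurrent V) : ∃ A, IsRecClass 𝕜 xy V A := by
  obtain ⟨A, -, hA⟩ := zorn_subset_nonempty
    {U : Set (ℝ → X) | U ⊆ REC 𝕜 X xy ∧ V ⊆ U ∧ JointlyRecurrent U} (by
      intro c hc hchain hne
      refine ⟨⋃₀ c, ⟨sUnion_subset fun U hU => (hc hU).1, ?_, ?_⟩,
        fun U hU => subset_sUnion_of_mem hU⟩
      · obtain ⟨U, hU⟩ := hne
        exact (hc hU).2.1.trans (subset_sUnion_of_mem hU)
      · intro n f hn hf
        obtain ⟨U, hU, hfU⟩ := hchain.directedOn.exists_mem_subset_of_finset_subset_biUnion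
          (f := id) hne (s := (Set.finite_range f).toFinset) (by
            intro g hg
            have hg' : g ∈ range f := by simpa using hg
            obtain ⟨i, rfl⟩ := hg'
            simpa [sUnion_eq_biUnion] using hf i)
        exact (hc hU).2.2 n f hn fun i => hfU (by simp)) V ⟨hV, Subset.rfl, hV2⟩
  exact ⟨A, hA⟩

end Spaces

section Conditions

variable {X : Type*} [NormedAddCommGroup X]

/-- The difference `Δ_h f (t) = f (t + h) - f t`. -/
def diff (h : ℝ) (f : ℝ → X) : ℝ → X := fun t => f (t + h) - f t

/-- The Loomis condition `(L_U)` for `A`. -/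
def SatL (U A : Set (ℝ → X)) : Prop :=
  ∀ F ∈ U, (∀ h : ℝ, 0 < h → diff h F ∈ A) → F ∈ A

variable [NormedSpace ℝ X]

/-- The indefinite integral `P f (t) = ∫₀ᵗ f`. -/
def prim (f : ℝ → X) : ℝ → X := fun t => ∫ s in (0 : ℝ)..t, f s

/-- The mean `M_h f (t) = (1/h) ∫₀ʰ f (t + s) ds`. -/
def mean (h : ℝ) (f : ℝ → X) : ℝ → X := fun t => h⁻¹ • ∫ s in (0 : ℝ)..h, f (t + s)

/-- The condition `(P_U)` for `A`. -/
def SatP (U A : Set (ℝ → X)) : Prop :=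
  ∀ f ∈ A, prim f ∈ U → prim f ∈ A

/-- The difference property `(Δ)` for `A`. -/
def SatDelta (A : Set (ℝ → X)) : Prop :=
  ∀ f : ℝ → X, LocallyIntegrable f volume → (∀ h : ℝ, 0 < h → diff h f ∈ A) →
    ∀ k : ℝ, 0 < k → f - mean k f ∈ A

end Conditions

end RecFun

end

/-!
Let `A` be a maximal class of jointly recurrent functions. The sets of joint `ε`-`K`-periods of
finitely many members of `A` generate a filter on `ℝ` (`jointPeriods`) with relatively dense
members. By maximality (`IsRecClass.mem_of_recAlong`), `A` consists of all `F ∈ C_xy` that are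
recurrent along this filter: `F (· + τ) → F` locally uniformly (`RecAlong`). So membership in `A`
splits into recurrence along a filter and membership in `C_xy`.

*Recurrence* (`recAlong_of_diff`). Let `F` be bounded and continuous with recurrent differences, and
suppose that `F` is not recurrent. The increments `F (· + τ) - F` then stay large somewhere on a fixed
compact set for arbitrarily good periods `τ` of the differences. Choosing `τ₀, τ₁, …` one by one, each
increment is nearly invariant under the sums of the earlier `τ`s and under a finer and finer grid.
Grid invariance makes the sets where the increments are large dense in the limit, and Baire's theorem
gives one point `t` at which infinitely many of them are large (`exists_isAdditiveSequence`). Near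
invariance under sums makes `F (t + ∑ τ) - F t` nearly additive, so that a series with bounded finite
partial sums has terms bounded away from zero. By the Bessaga–Pełczyński theorem
(`exists_subseq_c0_embedding`, proved with Rosenthal's disjointification lemma) a subsequence spans
`c₀`. This is excluded if `c₀ ⊄ X`; if the range of `F` is relatively weakly sequentially complete, the
partial sums of that subsequence would have a weak limit, which `c₀` forbids
(`not_tendsto_partialSums_of_c0_embedding`).

*Membership in `C_xy`* (`mem_Cxy_of_diff`). Since a recurrent function returns near `F 0` up to finitely
many translations, its range lies within each `ε` of finitely many translates of ranges of
differences; relative compactness passes from the differences to `F` at once, and relative weak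
compactness does by Grothendieck's lemma. Uniform continuity comes from Baire's theorem applied to the
step `h` (`exists_modulus_diff`) and averaging. For `(P_U)` the differences of `P f` are means of `f`,
and means respect weak compactness by Krein's theorem (`RelWeaklyCompact.range_integral`).

*The condition `(Δ)`* (`IsRecClass.satDelta`). First, `f` is continuous (`continuous_of_diff`). The
differences of `f - M_k f` lie in `C_xy` and are recurrent. If `xy` is `b` or `rwc`, then `f - M_k f` is
bounded by Baire's theorem and the case `c₀ ⊄ X` applies. If `xy` is `rc` or `urc`, the range of
`f - M_k f` is relatively compact, hence relatively weakly sequentially complete. If `xy` is `u` or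
`urwc`, equi-uniform continuity of the differences gives recurrence directly (`recAlong_sub_mean`).
-/

namespace RecFun

/-! ### Bounded series and copies of `c₀` -/

/-- Induction behind Rosenthal's disjointification lemma: the bound on the row sums drops by `δ`
at each step. -/
theorem exists_injective_offDiag_sum_le {δ : ℝ} (hδ : 0 < δ) (N : ℕ) :
    ∀ a : ℕ → ℕ → ℝ, (∀ j k, 0 ≤ a j k) → (∀ j (S : Finset ℕ), ∑ k ∈ S, a j k ≤ N * δ) →
      ∃ n : ℕ → ℕ, Function.Injective n ∧
        ∀ j (S : Finset ℕ), j ∉ S → ∑ k ∈ S, a (n j) (n k) ≤ δ := by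
  induction N with
  | zero =>
    intro a _ ha
    exact ⟨id, Function.injective_id, fun j S _ => (ha j S).trans (by simpa using hδ.le)⟩
  | succ N ih =>
    intro a h0 ha
    -- `ℕ` is split into the infinite sets `{Nat.pair p i | i}`
    by_cases hp : ∃ p, ∀ j (S : Finset ℕ), j ∉ S → ∑ k ∈ S, a (Nat.pair p j) (Nat.pair p k) ≤ δ
    · obtain ⟨p, hp⟩ := hp
      exact ⟨Nat.pair p, fun i j h => by simpa using h, hp⟩
    · push Not at hp
      choose j S hjS hS using hp
      have hinj : Function.Injective fun p => Nat.pair p (j p) := fun p q h => by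
        have := Nat.pair_eq_pair.1 h
        exact this.1
      -- one bad row from each set: its bad part lies off the selected rows
      obtain ⟨n, hn, hn'⟩ := ih (fun p q => a (Nat.pair p (j p)) (Nat.pair q (j q)))
        (fun _ _ => h0 _ _) (fun p Q => by
          have hd : Disjoint (Q.image fun q => Nat.pair q (j q))
              ((S p).image fun k => Nat.pair p k) := by
            rw [Finset.disjoint_left]
            intro m hm hm'
            obtain ⟨q, _, rfl⟩ := Finset.mem_image.1 hm
            obtain ⟨k, hk, hkq⟩ := Finset.mem_image.1 hm'
            obtain ⟨rfl, rfl⟩ := Nat.pair_eq_pair.1 hkq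
            exact hjS _ hk
          have h1 := ha (Nat.pair p (j p))
            ((Q.image fun q => Nat.pair q (j q)) ∪ ((S p).image fun k => Nat.pair p k))
          rw [Finset.sum_union hd, Finset.sum_image (fun _ _ _ _ h => hinj h),
            Finset.sum_image (fun _ _ _ _ h => (Nat.pair_eq_pair.1 h).2)] at h1
          have h2 := hS p
          push_cast at h1
          linarith)
      exact ⟨fun i => Nat.pair (n i) (j (n i)), hinj.comp hn, hn'⟩

/-- **Rosenthal's disjointification lemma** for a nonnegative matrix with bounded row sums. -/
theorem exists_strictMono_offDiag_sum_le (a : ℕ → ℕ → ℝ) (h0 : ∀ j k, 0 ≤ a j k) {C : ℝ}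
    (ha : ∀ j (S : Finset ℕ), ∑ k ∈ S, a j k ≤ C) {δ : ℝ} (hδ : 0 < δ) :
    ∃ n : ℕ → ℕ, StrictMono n ∧
      ∀ j (S : Finset ℕ), j ∉ S → ∑ k ∈ S, a (n j) (n k) ≤ δ := by
  obtain ⟨N, hN⟩ := exists_nat_ge (C / δ)
  obtain ⟨n, hn, hn'⟩ := exists_injective_offDiag_sum_le hδ N a h0
    (fun j S => (ha j S).trans ((div_le_iff₀ hδ).1 hN))
  obtain ⟨m, hm, hnm⟩ := strictMono_subseq_of_tendsto_atTop hn.nat_tendsto_atTop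
  refine ⟨n ∘ m, hnm, fun j S hj => ?_⟩
  have := hn' (m j) (S.image m) (by simpa [hm.injective.eq_iff] using hj)
  rwa [Finset.sum_image (fun _ _ _ _ h => hm.injective h)] at this

section

variable {𝕜 : Type*} [RCLike 𝕜] {X : Type*} [NormedAddCommGroup X] [NormedSpace 𝕜 X]

theorem sum_abs_le_of_forall_abs_sum_le {r : ℕ → ℝ} {C : ℝ}
    (h : ∀ S : Finset ℕ, |∑ j ∈ S, r j| ≤ C) (S : Finset ℕ) : ∑ j ∈ S, |r j| ≤ 2 * C := by
  rw [← Finset.sum_filter_add_sum_filter_not S (fun j => 0 ≤ r j)]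
  have h1 : ∑ j ∈ S with 0 ≤ r j, |r j| = ∑ j ∈ S with 0 ≤ r j, r j :=
    Finset.sum_congr rfl fun j hj => abs_of_nonneg (Finset.mem_filter.1 hj).2
  have h2 : ∑ j ∈ S with ¬ 0 ≤ r j, |r j| = -∑ j ∈ S with ¬ 0 ≤ r j, r j := by
    rw [← Finset.sum_neg_distrib]
    exact Finset.sum_congr rfl fun j hj =>
      abs_of_neg (not_le.1 (Finset.mem_filter.1 hj).2)
  rw [h1, h2]
  have := (abs_le.1 (h {j ∈ S | 0 ≤ r j})).2
  have := (abs_le.1 (h {j ∈ S | ¬ 0 ≤ r j})).1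
  linarith

theorem norm_le_abs_re_add_abs_im (z : 𝕜) : ‖z‖ ≤ |RCLike.re z| + |RCLike.im z| := by
  conv_lhs => rw [← RCLike.re_add_im z]
  refine (norm_add_le _ _).trans ?_
  rw [norm_mul, RCLike.norm_ofReal, RCLike.norm_ofReal]
  gcongr
  refine mul_le_of_le_one_right (abs_nonneg _) ?_
  by_cases hI : (RCLike.I : 𝕜) = 0
  · simp [hI]
  · exact (RCLike.norm_I_of_ne_zero hI).le

/-- A series with bounded finite partial sums is weakly absolutely summable. -/
theorem sum_norm_dual_le {x : ℕ → X} {C : ℝ} (hC : ∀ S : Finset ℕ, ‖∑ j ∈ S, x j‖ ≤ C)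
    (φ : StrongDual 𝕜 X) (S : Finset ℕ) : ∑ j ∈ S, ‖φ (x j)‖ ≤ 4 * C * ‖φ‖ := by
  have h (S : Finset ℕ) : ‖φ (∑ j ∈ S, x j)‖ ≤ C * ‖φ‖ :=
    (φ.le_opNorm _).trans (by rw [mul_comm]; gcongr; exact hC S)
  have hre := sum_abs_le_of_forall_abs_sum_le (r := fun j => RCLike.re (φ (x j)))
    (C := C * ‖φ‖) (fun S => by
      rw [← map_sum, ← map_sum]; exact (RCLike.abs_re_le_norm _).trans (h S)) S
  have him := sum_abs_le_of_forall_abs_sum_le (r := fun j => RCLike.im (φ (x j)))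
    (C := C * ‖φ‖) (fun S => by
      rw [← map_sum, ← map_sum]; exact (RCLike.abs_im_le_norm _).trans (h S)) S
  calc ∑ j ∈ S, ‖φ (x j)‖
      ≤ ∑ j ∈ S, (|RCLike.re (φ (x j))| + |RCLike.im (φ (x j))|) :=
        Finset.sum_le_sum fun j _ => norm_le_abs_re_add_abs_im _
    _ ≤ 4 * C * ‖φ‖ := by rw [Finset.sum_add_distrib]; linarith

theorem norm_sum_smul_le {x : ℕ → X} {C : ℝ} (hC : ∀ S : Finset ℕ, ‖∑ j ∈ S, x j‖ ≤ C)
    (b : ℕ → 𝕜) {m : ℝ} (S : Finset ℕ) (hb : ∀ j ∈ S, ‖b j‖ ≤ m) (hm : 0 ≤ m) :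
    ‖∑ j ∈ S, b j • x j‖ ≤ 4 * C * m := by
  have hC0 : 0 ≤ C := (norm_nonneg _).trans (hC ∅)
  refine NormedSpace.norm_le_dual_bound 𝕜 _ (by positivity) fun φ => ?_
  calc ‖φ (∑ j ∈ S, b j • x j)‖ ≤ ∑ j ∈ S, ‖b j‖ * ‖φ (x j)‖ := by
        rw [map_sum]
        refine (norm_sum_le _ _).trans (le_of_eq ?_)
        simp
    _ ≤ ∑ j ∈ S, m * ‖φ (x j)‖ := by
        gcongr with j hj
        exact hb j hj
    _ = m * ∑ j ∈ S, ‖φ (x j)‖ := by rw [Finset.mul_sum]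
    _ ≤ m * (4 * C * ‖φ‖) := by gcongr; exact sum_norm_dual_le hC φ S
    _ = _ := by ring

theorem norm_apply_le_c0 (b : C₀(ℕ, 𝕜)) (j : ℕ) : ‖b j‖ ≤ ‖b‖ := by
  rw [← ZeroAtInftyContinuousMap.norm_toBCF_eq_norm]
  exact b.toBCF.norm_coe_le_norm j

theorem norm_le_c0 (b : C₀(ℕ, 𝕜)) {M : ℝ} (hM : 0 ≤ M) (h : ∀ j, ‖b j‖ ≤ M) : ‖b‖ ≤ M := by
  rw [← ZeroAtInftyContinuousMap.norm_toBCF_eq_norm]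
  exact (BoundedContinuousFunction.norm_le hM).2 h

theorem tendsto_cofinite_c0 (b : C₀(ℕ, 𝕜)) : Tendsto b cofinite (𝓝 0) := by
  have := zero_at_infty b
  rwa [cocompact_eq_cofinite] at this

theorem summable_c0_smul [CompleteSpace X] {x : ℕ → X} {C : ℝ}
    (hC : ∀ S : Finset ℕ, ‖∑ j ∈ S, x j‖ ≤ C) (b : C₀(ℕ, 𝕜)) : Summable fun j => b j • x j := by
  have hC0 : 0 ≤ C := (norm_nonneg _).trans (hC ∅)
  rw [summable_iff_vanishing_norm]
  intro ε hε
  have hη : 0 < ε / (4 * C + 1) := by positivity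
  have h1 := (tendsto_cofinite_c0 b).eventually (Metric.ball_mem_nhds 0 hη)
  refine ⟨Set.Finite.toFinset h1, fun S hS => ?_⟩
  have h2 : ‖∑ j ∈ S, b j • x j‖ ≤ 4 * C * (ε / (4 * C + 1)) := by
    refine norm_sum_smul_le hC _ S (fun j hj => ?_) hη.le
    by_contra hlt
    refine Finset.disjoint_left.1 hS hj ((Set.Finite.mem_toFinset _).2 ?_)
    simp only [mem_compl_iff, mem_ofPred_eq, dist_zero_right]
    exact fun h => hlt h.le
  refine h2.trans_lt ?_
  rw [mul_div_assoc', div_lt_iff₀ (by positivity)]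
  nlinarith

/-- **Bessaga–Pełczyński**: a series with bounded finite partial sums whose terms are bounded away
from zero has a subsequence equivalent to the unit vector basis of `c₀`. -/
theorem exists_subseq_c0_embedding [CompleteSpace X] {x : ℕ → X} {C : ℝ}
    (hC : ∀ S : Finset ℕ, ‖∑ j ∈ S, x j‖ ≤ C) {ε : ℝ} (hε : 0 < ε) (hx : ∀ j, ε ≤ ‖x j‖) :
    ∃ n : ℕ → ℕ, StrictMono n ∧ ∃ T : C₀(ℕ, 𝕜) →L[𝕜] X,
      (∃ c : NNReal, AntilipschitzWith c T) ∧ ∀ b, HasSum (fun j => b j • x (n j)) (T b) := by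
  have hC0 : 0 ≤ C := (norm_nonneg _).trans (hC ∅)
  choose φ hφ hφx using fun j => exists_dual_vector'' 𝕜 (x j)
  obtain ⟨n, hn, hoff⟩ := exists_strictMono_offDiag_sum_le (fun j k => ‖φ j (x k)‖)
    (fun _ _ => norm_nonneg _) (C := 4 * C) (fun j S => (sum_norm_dual_le hC (φ j) S).trans
      (mul_le_of_le_one_right (by positivity) (hφ j))) (half_pos hε)
  have hC' (S : Finset ℕ) : ‖∑ j ∈ S, x (n j)‖ ≤ C := by
    have := hC (S.image n)
    rwa [Finset.sum_image (fun _ _ _ _ h => hn.injective h)] at this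
  have hsum (b : C₀(ℕ, 𝕜)) := summable_c0_smul hC' b
  let T₀ : C₀(ℕ, 𝕜) →ₗ[𝕜] X :=
    { toFun := fun b => ∑' j, b j • x (n j)
      map_add' := fun b b' => by
        rw [← (hsum b).tsum_add (hsum b')]
        exact tsum_congr fun j => by simp [add_smul]
      map_smul' := fun c b => by
        rw [RingHom.id_apply, ← (hsum b).tsum_const_smul]
        exact tsum_congr fun j => by simp [mul_smul] }
  have hT₀ (b) : HasSum (fun j => b j • x (n j)) (T₀ b) := (hsum b).hasSum
  let T : C₀(ℕ, 𝕜) →L[𝕜] X := T₀.mkContinuous (4 * C) fun b =>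
    le_of_tendsto (hT₀ b).norm (Eventually.of_forall fun S =>
      norm_sum_smul_le hC' b S (fun j _ => norm_apply_le_c0 b j) (norm_nonneg _))
  refine ⟨n, hn, T, ⟨⟨2 / ε, by positivity⟩, ?_⟩, hT₀⟩
  refine T.antilipschitz_of_bound fun b => ?_
  have hj (j : ℕ) : ε * ‖b j‖ ≤ ‖T b‖ + ‖b‖ * (ε / 2) := by
    have hlim := ((φ (n j)).hasSum (hT₀ b)).norm
    have h1 : ε * ‖b j‖ - ‖b‖ * (ε / 2) ≤ ‖φ (n j) (T₀ b)‖ := by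
      refine ge_of_tendsto hlim ?_
      filter_upwards [eventually_ge_atTop {j}] with S hS
      have hjS : j ∈ S := hS (Finset.mem_singleton_self j)
      rw [← Finset.add_sum_erase S _ hjS]
      have h2 : ‖φ (n j) (b j • x (n j))‖ = ‖b j‖ * ‖x (n j)‖ := by
        rw [map_smul, norm_smul, hφx]; simp
      have h3 : ‖∑ k ∈ S.erase j, φ (n j) (b k • x (n k))‖ ≤ ‖b‖ * (ε / 2) := by
        calc _ ≤ ∑ k ∈ S.erase j, ‖b‖ * ‖φ (n j) (x (n k))‖ := by
              refine (norm_sum_le _ _).trans (Finset.sum_le_sum fun k _ => ?_)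
              rw [map_smul, norm_smul]
              gcongr
              exact norm_apply_le_c0 b k
          _ ≤ ‖b‖ * (ε / 2) := by
              rw [← Finset.mul_sum]
              gcongr
              exact hoff j _ (Finset.notMem_erase j S)
      have h4 : ε * ‖b j‖ ≤ ‖b j‖ * ‖x (n j)‖ := by
        rw [mul_comm]; gcongr; exact hx _
      have h5 := norm_sub_le_norm_add (φ (n j) (b j • x (n j)))
        (∑ k ∈ S.erase j, φ (n j) (b k • x (n k)))
      linarith
    have h6 : ‖φ (n j) (T₀ b)‖ ≤ ‖T b‖ := by
      refine ((φ (n j)).le_opNorm _).trans ?_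
      exact mul_le_of_le_one_left (norm_nonneg _) (hφ _)
    linarith
  have h7 : ‖b‖ ≤ (‖T b‖ + ‖b‖ * (ε / 2)) / ε :=
    norm_le_c0 b (by positivity) fun j => by rw [le_div_iff₀ hε]; linarith [hj j]
  rw [le_div_iff₀ hε] at h7
  change ‖b‖ ≤ 2 / ε * ‖T b‖
  rw [div_mul_eq_mul_div, le_div_iff₀ hε]
  linarith

theorem containsC0_of_antilipschitz [CompleteSpace X] (T : C₀(ℕ, 𝕜) →L[𝕜] X) {c : NNReal}
    (hT : AntilipschitzWith c T) : ContainsC0 𝕜 X :=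
  ⟨_, ⟨T.equivRange hT.injective (hT.isClosed_range T.uniformContinuous)⟩⟩

/-- Convergence in the weak topology is tested on functionals. -/
theorem tendsto_toWeakSpace_iff {α : Type*} {l : Filter α} {f : α → X} {a : X} :
    Tendsto (fun i => toWeakSpace 𝕜 X (f i)) l (𝓝 (toWeakSpace 𝕜 X a)) ↔
      ∀ φ : StrongDual 𝕜 X, Tendsto (fun i => φ (f i)) l (𝓝 (φ a)) := by
  rw [(NormedSpace.isEmbedding_inclusionInDoubleDualWeak 𝕜 X).tendsto_nhds_iff,
    tendsto_iff_forall_eval_tendsto_topDualPairing]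
  rfl

variable [NormedSpace ℝ X] [IsScalarTower ℝ 𝕜 X]

theorem isClosed_toWeakSpace_image {s : Set X} (hs : Convex ℝ s) (hc : IsClosed s) :
    IsClosed (toWeakSpace 𝕜 X '' s) := by
  have := hs.toWeakSpace_closure 𝕜
  rw [hc.closure_eq] at this
  rw [this]
  exact isClosed_closure

/-- If `x` spans a copy of `c₀`, its partial sums have no weak limit: a limit would lie in the copy,
and would correspond there to the constant sequence `1`. -/
theorem not_tendsto_partialSums_of_c0_embedding {x : ℕ → X}
    (T : C₀(ℕ, 𝕜) →L[𝕜] X) {c : NNReal} [CompleteSpace X]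
    (hT : AntilipschitzWith c T) (hTx : ∀ b, HasSum (fun j => b j • x j) (T b)) (a : X)
    (ha : ∀ φ : StrongDual 𝕜 X,
      Tendsto (fun m => φ (∑ j ∈ Finset.range m, x j)) atTop (𝓝 (φ a))) : False := by
  have hcl := hT.isClosed_range T.uniformContinuous
  -- the unit vectors of `c₀`
  let e (i : ℕ) : C₀(ℕ, 𝕜) :=
    { toFun := fun j => if j = i then 1 else 0
      continuous_toFun := continuous_of_discreteTopology
      zero_at_infty' := by
        rw [cocompact_eq_cofinite]
        refine tendsto_const_nhds.congr' ?_
        have : {i}ᶜ ∈ (cofinite : Filter ℕ) := (Set.finite_singleton i).compl_mem_cofinite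
        filter_upwards [this] with j hj
        exact (if_neg hj).symm }
  have he (i) : T (e i) = x i := by
    refine (hTx (e i)).unique ?_
    have h := hasSum_ite_eq (β := ℕ) i (x i)
    convert h using 2 with j
    by_cases hj : j = i
    · subst hj; simp [e]
    · simp [e, hj]
  have hmem : a ∈ range T := by
    have hcl' : IsClosed (toWeakSpace 𝕜 X '' range T) := by
      refine isClosed_toWeakSpace_image ?_ hcl
      have := ((LinearMap.range (T : C₀(ℕ, 𝕜) →ₗ[𝕜] X)).restrictScalars ℝ).convex
      exact this
    have h1 := hcl'.mem_of_tendsto (tendsto_toWeakSpace_iff.2 ha) (Eventually.of_forall fun m =>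
      ⟨_, ⟨∑ j ∈ Finset.range m, e j, by simp [he]⟩, rfl⟩)
    obtain ⟨y, hy, hya⟩ := h1
    rwa [← (toWeakSpace 𝕜 X).injective hya]
  obtain ⟨b, rfl⟩ := hmem
  let E := T.equivRange hT.injective hcl
  have hb (i : ℕ) : b i = 1 := by
    let ev : StrongDual 𝕜 C₀(ℕ, 𝕜) := LinearMap.mkContinuous
      { toFun := fun b => b i
        map_add' := fun _ _ => rfl
        map_smul' := fun _ _ => rfl } 1 fun b => by simpa using norm_apply_le_c0 b i
    obtain ⟨ψ, hψ, -⟩ := exists_extension_norm_eq _ (ev.comp (E.symm : T.range →L[𝕜] C₀(ℕ, 𝕜)))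
    have hψ' (b) : ψ (T b) = b i := by
      have h := hψ (E b)
      have h2 : ((E b : T.range) : X) = T b := rfl
      rw [h2] at h
      rw [h]
      simp [ev]
    have h1 := ha ψ
    refine tendsto_nhds_unique (hψ' b ▸ h1) (tendsto_const_nhds.congr' ?_)
    filter_upwards [eventually_gt_atTop i] with m hm
    rw [map_sum]
    simp_rw [← he, hψ']
    have : ∀ j, (e j) i = if i = j then (1 : 𝕜) else 0 := fun j => rfl
    simp [this, hm]
  have h1 := tendsto_cofinite_c0 b
  have h2 : (b : ℕ → 𝕜) = fun _ => 1 := funext hb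
  rw [h2] at h1
  exact one_ne_zero (tendsto_nhds_unique tendsto_const_nhds h1)

end

/-! ### Recurrence along a filter -/

section

variable {X : Type*} [NormedAddCommGroup X]

/-- `f` is recurrent along the filter `l` on `ℝ`: `f (· + τ) → f` locally uniformly as `τ → l`. -/
def RecAlong (l : Filter ℝ) (f : ℝ → X) : Prop :=
  ∀ K : Set ℝ, IsCompact K → ∀ ε : ℝ, 0 < ε → ∀ᶠ τ in l, ∀ t ∈ K, ‖f (t + τ) - f t‖ ≤ ε

variable {l : Filter ℝ} {f g F : ℝ → X}

theorem RecAlong.of_Icc (h : ∀ R : ℝ, 1 ≤ R → ∀ ε : ℝ, 0 < ε →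
    ∀ᶠ τ in l, ∀ t ∈ Icc (-R) R, ‖f (t + τ) - f t‖ ≤ ε) : RecAlong l f := by
  intro K hK ε hε
  obtain ⟨R, hR⟩ := hK.isBounded.subset_closedBall 0
  filter_upwards [h (max R 1) (le_max_right _ _) ε hε] with τ hτ t ht
  refine hτ t ?_
  have := hR ht
  rw [Real.closedBall_eq_Icc] at this
  constructor <;> linarith [this.1, this.2, le_max_left R 1]

theorem RecAlong.comp_add (hf : RecAlong l f) (s : ℝ) : RecAlong l fun t => f (t + s) := by
  intro K hK ε hε
  filter_upwards [hf _ (hK.image (continuous_id.add continuous_const : Continuous (· + s))) ε hε]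
    with τ hτ t ht
  rw [add_right_comm]
  exact hτ _ (mem_image_of_mem _ ht)

theorem RecAlong.neg (hf : RecAlong l f) : RecAlong l fun t => -f t := by
  intro K hK ε hε
  filter_upwards [hf K hK ε hε] with τ hτ t ht
  rw [neg_sub_neg, norm_sub_rev]
  exact hτ t ht

theorem RecAlong.add (hf : RecAlong l f) (hg : RecAlong l g) : RecAlong l fun t => f t + g t := by
  intro K hK ε hε
  filter_upwards [hf K hK _ (half_pos hε), hg K hK _ (half_pos hε)] with τ hτ hτ' t ht
  rw [add_sub_add_comm]
  linarith [norm_add_le (f (t + τ) - f t) (g (t + τ) - g t), hτ t ht, hτ' t ht]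

theorem RecAlong.sub (hf : RecAlong l f) (hg : RecAlong l g) : RecAlong l fun t => f t - g t := by
  simpa only [sub_eq_add_neg] using hf.add hg.neg

/-- Recurrence of the positive differences gives that of all differences. -/
theorem recAlong_diff_of_pos (h : ∀ h : ℝ, 0 < h → RecAlong l (diff h F)) (s : ℝ) :
    RecAlong l (diff s F) := by
  rcases lt_trichotomy s 0 with hs | rfl | hs
  · convert ((h (-s) (by linarith)).comp_add s).neg using 1
    ext t
    simp [diff]
  · intro K _ ε hε
    exact Eventually.of_forall fun τ t _ => by simpa [diff] using hε.le
  · exact h s hs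

/-- A grid of step `1 / (n + 1)` that reaches from `-(n + 1)` to `n + 1`. -/
noncomputable def grid (n : ℕ) : Finset ℝ :=
  (Finset.Icc (-((n : ℤ) + 1) ^ 2) (((n : ℤ) + 1) ^ 2)).image fun i : ℤ => (i : ℝ) / (n + 1)

theorem eventually_exists_grid_add_mem_Ioo {a b : ℝ} (hab : a < b) (R : ℝ) :
    ∀ᶠ n in atTop, ∀ s ∈ Icc (-R) R, ∃ h ∈ grid n, s + h ∈ Ioo a b := by
  set c := (a + b) / 2 with hc
  obtain ⟨N, hN⟩ := exists_nat_ge (max (|c| + R + 1) (2 / (b - a)))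
  filter_upwards [eventually_ge_atTop N] with n hn s hs
  have hn' : (N : ℝ) ≤ n := by exact_mod_cast hn
  have h1 : |c| + R + 1 ≤ n := (le_max_left _ _).trans (hN.trans hn')
  have h2 : 2 / (b - a) ≤ n := (le_max_right _ _).trans (hN.trans hn')
  have hpos : (0 : ℝ) < n + 1 := by positivity
  have hcs : |c - s| ≤ |c| + R := (abs_sub _ _).trans (by gcongr; exact abs_le.2 hs)
  have hcs' := abs_le.1 hcs
  have hfl := Int.floor_le ((c - s) * (n + 1))
  have hfl' := Int.lt_floor_add_one ((c - s) * (n + 1))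
  set i := ⌊(c - s) * ((n : ℝ) + 1)⌋ with hi
  refine ⟨(i : ℝ) / (n + 1), Finset.mem_image.2 ⟨i, Finset.mem_Icc.2 ⟨?_, ?_⟩, rfl⟩, ?_⟩
  · have : -((n : ℝ) + 1) ^ 2 ≤ (i : ℝ) := by nlinarith
    exact_mod_cast this
  · have : (i : ℝ) ≤ ((n : ℝ) + 1) ^ 2 := by nlinarith
    exact_mod_cast this
  · have hb : 2 ≤ n * (b - a) := (div_le_iff₀ (by linarith)).1 h2
    have h3 : (i : ℝ) / (n + 1) ≤ c - s := by rw [div_le_iff₀ hpos]; exact hfl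
    have h4 : c - s - (b - a) / 2 < (i : ℝ) / (n + 1) := by
      rw [lt_div_iff₀ hpos]; nlinarith
    constructor <;> linarith

/-- The increments `F (t + τ) - F t` along `τ` are bounded below by `ε` and almost independent of
translations by the earlier sums of the `τ`s. -/
def IsAdditiveSequence (F : ℝ → X) (t : ℝ) (τ : ℕ → ℝ) (ε : ℝ) : Prop :=
  (∀ n, ε ≤ ‖F (t + τ n) - F t‖) ∧
  ∀ n, ∀ S ⊆ Finset.range n, ‖(F (t + ∑ j ∈ S, τ j + τ n) - F (t + ∑ j ∈ S, τ j)) -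
    (F (t + τ n) - F t)‖ ≤ ε * (1 / 2) ^ n

theorem IsAdditiveSequence.comp {t ε : ℝ} {τ : ℕ → ℝ} (hε : 0 ≤ ε)
    (h : IsAdditiveSequence F t τ ε) {n : ℕ → ℕ} (hn : StrictMono n) :
    IsAdditiveSequence F t (τ ∘ n) ε := by
  refine ⟨fun k => h.1 _, fun k S hS => ?_⟩
  have h1 := h.2 (n k) (S.image n) (by
    intro i hi
    obtain ⟨j, hj, rfl⟩ := Finset.mem_image.1 hi
    exact Finset.mem_range.2 (hn (Finset.mem_range.1 (hS hj))))
  rw [Finset.sum_image (fun _ _ _ _ h => hn.injective h)] at h1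
  refine h1.trans ?_
  gcongr ε * ?_
  exact pow_le_pow_of_le_one (by norm_num) (by norm_num) hn.le_apply

/-- If `F` is not recurrent along `l` although all its differences are, there is a point at which
infinitely many increments stay large, with each of them almost independent of translations by the
earlier ones. The point comes from Baire's theorem: each increment is large on an open set that
is almost invariant under the translations of a grid, so these sets become dense. -/
theorem exists_isAdditiveSequence (hF : Continuous F) (hd : ∀ h, RecAlong l (diff h F))
    (hnot : ¬ RecAlong l F) :
    ∃ ε > 0, ∃ t, ∃ τ, IsAdditiveSequence F t τ ε := by
  obtain ⟨R, hR, ε, hε, hfreq⟩ : ∃ R : ℝ, 1 ≤ R ∧ ∃ ε : ℝ, 0 < ε ∧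
      ∃ᶠ τ in l, ∃ t ∈ Icc (-R) R, ε < ‖F (t + τ) - F t‖ := by
    by_contra! h
    refine hnot (RecAlong.of_Icc fun R hR ε hε => ?_)
    exact h R hR ε hε
  have key (H : Finset ℝ) {δ : ℝ} (hδ : 0 < δ) : ∃ τ, ∃ t ∈ Icc (-R) R, ε < ‖F (t + τ) - F t‖ ∧
      ∀ h ∈ H, ∀ t ∈ Icc (-R) R, ‖(F (t + h + τ) - F (t + h)) - (F (t + τ) - F t)‖ ≤ δ := by
    have h1 : ∀ᶠ τ in l, ∀ h ∈ H, ∀ t ∈ Icc (-R) R,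
        ‖(F (t + h + τ) - F (t + h)) - (F (t + τ) - F t)‖ ≤ δ := by
      rw [Filter.eventually_all_finset]
      intro h _
      filter_upwards [hd h _ (isCompact_Icc (a := -R) (b := R)) δ hδ] with τ hτ t ht
      have := hτ t ht
      simp only [diff] at this
      convert this using 2
      rw [add_right_comm]
      abel
    obtain ⟨τ, ⟨t, ht, hlt⟩, hτ⟩ := (hfreq.and_eventually h1).exists
    exact ⟨τ, t, ht, hlt, hτ⟩
  have hδ (n : ℕ) : 0 < ε / 2 * (1 / 2) ^ n := by positivity
  choose T s hs hlt hT using fun (H : Finset ℝ) (n : ℕ) => key (H ∪ grid n) (hδ n)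
  -- `H n` contains all sums of the first `n` translations
  let H : ℕ → Finset ℝ := fun n =>
    Nat.rec {0} (fun n H => H ∪ H.image (· + T H n)) n
  have hH0 : H 0 = {0} := rfl
  have hHs (n) : H (n + 1) = H n ∪ (H n).image (· + T (H n) n) := rfl
  set τ : ℕ → ℝ := fun n => T (H n) n with hτ
  have hsums (n : ℕ) : ∀ S ⊆ Finset.range n, ∑ j ∈ S, τ j ∈ H n := by
    induction n with
    | zero =>
      intro S hS
      have : S = ∅ := by simpa using hS
      simp [this, hH0]
    | succ n ih =>
      intro S hS
      rw [hHs]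
      by_cases hn : n ∈ S
      · refine Finset.mem_union_right _ (Finset.mem_image.2 ⟨_, ih (S.erase n) ?_, ?_⟩)
        · intro i hi
          have h1 := Finset.mem_range.1 (hS (Finset.mem_of_mem_erase hi))
          have h2 := Finset.ne_of_mem_erase hi
          exact Finset.mem_range.2 (by omega)
        · exact Finset.sum_erase_add S _ hn
      · refine Finset.mem_union_left _ (ih S fun i hi => ?_)
        have h1 := Finset.mem_range.1 (hS hi)
        have h2 : i ≠ n := fun h => hn (h ▸ hi)
        exact Finset.mem_range.2 (by omega)
  let U (n : ℕ) : Set ℝ := {t | ε / 2 < ‖F (t + τ n) - F t‖}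
  have hU (n) : IsOpen (U n) := isOpen_lt continuous_const (by fun_prop)
  have hsub (n : ℕ) : ∀ h ∈ grid n, s (H n) n + h ∈ U n := by
    intro h hh
    have h1 := hT (H n) n h (Finset.mem_union_right _ hh) _ (hs (H n) n)
    have h2 := hlt (H n) n
    have h3 : ε / 2 * (1 / 2) ^ n ≤ ε / 2 * 1 := by
      gcongr
      exact pow_le_one₀ (by norm_num) (by norm_num)
    have h4 := norm_sub_norm_le (F (s (H n) n + τ n) - F (s (H n) n))
      (F (s (H n) n + h + τ n) - F (s (H n) n + h))
    rw [norm_sub_rev (F (s (H n) n + τ n) - F (s (H n) n))] at h4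
    change ε / 2 < ‖F (s (H n) n + h + τ n) - F (s (H n) n + h)‖
    simp only [hτ] at h4 ⊢
    linarith
  have hdense (n : ℕ) : Dense (⋃ m ≥ n, U m) := by
    rw [dense_iff_inter_open]
    intro V hV ⟨x, hx⟩
    obtain ⟨a, b, hab, hVab⟩ := mem_nhds_iff_exists_Ioo_subset.1 (hV.mem_nhds hx)
    obtain ⟨m, hm, hmn⟩ := ((eventually_exists_grid_add_mem_Ioo (hab.1.trans hab.2) R).and
      (eventually_ge_atTop n)).exists
    obtain ⟨h, hh, hmem⟩ := hm _ (hs (H m) m)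
    exact ⟨_, hVab hmem, mem_iUnion₂.2 ⟨m, hmn, hsub m h hh⟩⟩
  obtain ⟨t, ht01, ht⟩ := (dense_iInter_of_isOpen_nat
    (fun n => isOpen_biUnion fun m (_ : m ≥ n) => hU m) hdense).inter_open_nonempty
      (Ioo 0 1) isOpen_Ioo ⟨1 / 2, by norm_num, by norm_num⟩
  have htR : t ∈ Icc (-R) R := ⟨by linarith [ht01.1], by linarith [ht01.2]⟩
  obtain ⟨n, hn, hnU⟩ := Filter.extraction_of_frequently_atTop (P := fun n => t ∈ U n) (by
    rw [Filter.frequently_atTop]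
    intro n
    obtain ⟨m, hm, hmU⟩ := mem_iUnion₂.1 (mem_iInter.1 ht n)
    exact ⟨m, hm, hmU⟩)
  refine ⟨ε / 2, half_pos hε, t, τ ∘ n, fun k => (hnU k).le, fun k S hS => ?_⟩
  have h1 := hT (H (n k)) (n k) (∑ j ∈ S.image n, τ j) (Finset.mem_union_left _ (hsums _ _ (by
    intro i hi
    obtain ⟨j, hj, rfl⟩ := Finset.mem_image.1 hi
    exact Finset.mem_range.2 (hn (Finset.mem_range.1 (hS hj)))))) t htR
  rw [Finset.sum_image (fun _ _ _ _ h => hn.injective h)] at h1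
  refine h1.trans ?_
  gcongr ε / 2 * ?_
  exact pow_le_pow_of_le_one (by norm_num) (by norm_num) hn.le_apply

theorem sum_half_pow_le (S : Finset ℕ) : ∑ j ∈ S, (1 / 2 : ℝ) ^ j ≤ 2 := by
  exact (summable_geometric_two.sum_le_tsum S fun _ _ => by positivity).trans
    tsum_geometric_two.le

theorem IsAdditiveSequence.norm_sum_sub_le {t ε : ℝ} {τ : ℕ → ℝ}
    (h : IsAdditiveSequence F t τ ε) (S : Finset ℕ) :
    ‖∑ j ∈ S, (F (t + τ j) - F t) - (F (t + ∑ j ∈ S, τ j) - F t)‖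
      ≤ ∑ j ∈ S, ε * (1 / 2) ^ j := by
  induction S using Finset.induction_on_max with
  | empty => simp
  | insert a S hS ih =>
    have ha : a ∉ S := fun h => lt_irrefl _ (hS a h)
    rw [Finset.sum_insert ha, Finset.sum_insert ha, Finset.sum_insert ha]
    have h1 := h.2 a S fun i hi => Finset.mem_range.2 (hS i hi)
    rw [norm_sub_rev] at h1
    refine le_trans (le_of_eq ?_) ((norm_add_le _ _).trans (add_le_add h1 ih))
    congr 1
    rw [add_comm (τ a), ← add_assoc]
    abel

theorem IsAdditiveSequence.exists_bound {t ε : ℝ} {τ : ℕ → ℝ} (hε : 0 ≤ ε)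
    (h : IsAdditiveSequence F t τ ε) (hF : Bornology.IsBounded (range F)) :
    ∃ C, ∀ S : Finset ℕ, ‖∑ j ∈ S, (F (t + τ j) - F t)‖ ≤ C := by
  obtain ⟨B, hB⟩ := hF.exists_norm_le
  refine ⟨ε * 2 + (B + B), fun S => ?_⟩
  have h1 := h.norm_sum_sub_le S
  rw [← Finset.mul_sum] at h1
  have h2 : ε * ∑ j ∈ S, (1 / 2 : ℝ) ^ j ≤ ε * 2 := by gcongr; exact sum_half_pow_le S
  have h3 := norm_sub_norm_le (∑ j ∈ S, (F (t + τ j) - F t)) (F (t + ∑ j ∈ S, τ j) - F t)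
  have h4 := norm_sub_le (F (t + ∑ j ∈ S, τ j)) (F t)
  have h5 := hB _ (mem_range_self (t + ∑ j ∈ S, τ j))
  have h6 := hB _ (mem_range_self t)
  linarith

end

section

variable {𝕜 : Type*} [RCLike 𝕜] {X : Type*} [NormedAddCommGroup X] [NormedSpace ℝ X]
  [NormedSpace 𝕜 X] [IsScalarTower ℝ 𝕜 X] [CompleteSpace X] {l : Filter ℝ} {F : ℝ → X}

/-- **Loomis–Kadets theorem along a filter**: a bounded continuous function with recurrent
differences is itself recurrent if `X` does not contain `c₀`, or if its range is relatively weakly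
sequentially complete. -/
theorem recAlong_of_diff (hF : F ∈ Cb X)
    (hX : ¬ ContainsC0 𝕜 X ∨ RelWeaklySeqComplete 𝕜 (range F))
    (hd : ∀ h : ℝ, 0 < h → RecAlong l (diff h F)) : RecAlong l F := by
  by_contra hnot
  obtain ⟨ε, hε, t, τ, hτ⟩ := exists_isAdditiveSequence hF.1 (recAlong_diff_of_pos hd) hnot
  obtain ⟨C, hC⟩ := hτ.exists_bound hε.le hF.2
  obtain ⟨n, hn, T, ⟨c, hT⟩, hTx⟩ := exists_subseq_c0_embedding (𝕜 := 𝕜) hC hε hτ.1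
  rcases hX with hX | hX
  · exact hX (containsC0_of_antilipschitz T hT)
  · replace hτ := hτ.comp hε.le hn
    obtain ⟨C, hC⟩ := hτ.exists_bound hε.le hF.2
    set x : ℕ → X := fun j => F (t + (τ ∘ n) j) - F t with hx
    let y : ℕ → X := fun m => F (t + ∑ j ∈ Finset.range m, (τ ∘ n) j)
    let e : ℕ → X := fun m => y m - F t - ∑ j ∈ Finset.range m, x j
    have he : CauchySeq e := by
      refine cauchySeq_of_le_geometric (1 / 2) ε (by norm_num) fun m => ?_
      have h1 := hτ.2 m (Finset.range m) Finset.Subset.rfl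
      rw [dist_comm, dist_eq_norm]
      refine le_trans (le_of_eq (congrArg _ ?_)) h1
      simp only [e, y, x, Finset.sum_range_succ, ← add_assoc]
      abel
    obtain ⟨e₀, he₀⟩ := cauchySeq_tendsto_of_complete he
    have hy (φ : StrongDual 𝕜 X) (m : ℕ) :
        φ (y m) = φ (F t) + φ (e m) + ∑ j ∈ Finset.range m, φ (x j) := by
      have h1 : y m = F t + e m + ∑ j ∈ Finset.range m, x j := by
        simp only [e]
        abel
      rw [h1, map_add, map_add, map_sum]
    obtain ⟨a, ha⟩ := hX y (fun m => mem_range_self _) fun φ => by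
      have hs : Summable fun j => φ (x j) := by
        refine Summable.of_norm (summable_of_sum_le (c := 4 * C * ‖φ‖) (fun _ => norm_nonneg _)
          (sum_norm_dual_le hC φ))
      simp_rw [hy]
      exact ((tendsto_const_nhds.add ((φ.continuous.tendsto _).comp he₀)).add
        hs.hasSum.tendsto_sum_nat).cauchySeq
    refine not_tendsto_partialSums_of_c0_embedding T hT hTx (a - F t - e₀) fun φ => ?_
    have h1 : (fun m => φ (∑ j ∈ Finset.range m, x j)) =
        fun m => φ (y m) - φ (F t) - φ (e m) := by
      ext m
      rw [hy, map_sum]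
      ring
    have h2 := ((ha φ).sub_const (φ (F t))).sub ((φ.continuous.tendsto _).comp he₀)
    rw [map_sub, map_sub]
    exact h1 ▸ h2

end

/-! ### Relatively weakly compact sets -/

section

variable {𝕜 : Type*} [RCLike 𝕜] {X : Type*} [NormedAddCommGroup X] [NormedSpace 𝕜 X]

theorem RelWeaklyCompact.of_subset {M : Set X} {C : Set (WeakSpace 𝕜 X)} (hC : IsCompact C)
    (h : toWeakSpace 𝕜 X '' M ⊆ C) : RelWeaklyCompact 𝕜 M :=
  hC.closure_of_subset h

theorem RelWeaklyCompact.mono {M N : Set X} (hN : RelWeaklyCompact 𝕜 N) (h : M ⊆ N) :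
    RelWeaklyCompact 𝕜 M :=
  .of_subset hN ((image_mono h).trans subset_closure)

theorem relWeaklyCompact_of_isCompact {M : Set X} (hM : IsCompact M) : RelWeaklyCompact 𝕜 M :=
  .of_subset (hM.image (toWeakSpaceCLM 𝕜 X).continuous) Subset.rfl

theorem RelWeaklyCompact.sub {M N : Set X} (hM : RelWeaklyCompact 𝕜 M)
    (hN : RelWeaklyCompact 𝕜 N) : RelWeaklyCompact 𝕜 (M - N) := by
  refine .of_subset (IsCompact.image (IsCompact.prod hM hN) continuous_sub) ?_
  rintro _ ⟨_, ⟨x, hx, y, hy, rfl⟩, rfl⟩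
  exact ⟨(_, _), ⟨subset_closure (mem_image_of_mem _ hx), subset_closure (mem_image_of_mem _ hy)⟩,
    (map_sub _ _ _).symm⟩

theorem RelWeaklyCompact.biUnion_finset {ι : Type*} (S : Finset ι) {M : ι → Set X}
    (hM : ∀ i ∈ S, RelWeaklyCompact 𝕜 (M i)) : RelWeaklyCompact 𝕜 (⋃ i ∈ S, M i) := by
  refine .of_subset (S.isCompact_biUnion hM) ?_
  simp only [image_iUnion]
  exact iUnion₂_mono fun i _ => subset_closure

theorem RelWeaklyCompact.smul {M : Set X} (hM : RelWeaklyCompact 𝕜 M) (c : 𝕜) :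
    RelWeaklyCompact 𝕜 (c • M) := by
  refine .of_subset (IsCompact.image hM (continuous_const_smul c)) ?_
  rintro _ ⟨_, ⟨x, hx, rfl⟩, rfl⟩
  exact ⟨toWeakSpace 𝕜 X x, subset_closure (mem_image_of_mem _ hx), (map_smul _ _ _).symm⟩

/-- Functionals are continuous for the weak topology. -/
theorem continuous_weakSpace_dual (φ : StrongDual 𝕜 X) :
    Continuous fun x : WeakSpace 𝕜 X => φ ((toWeakSpace 𝕜 X).symm x) :=
  WeakBilin.eval_continuous (topDualPairing 𝕜 X).flip φ

theorem RelWeaklyCompact.isBounded {M : Set X} (hM : RelWeaklyCompact 𝕜 M) :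
    Bornology.IsBounded M := by
  obtain ⟨C, hC⟩ := banach_steinhaus (𝕜 := 𝕜) (𝕜₂ := 𝕜)
    (g := fun x : M => NormedSpace.inclusionInDoubleDual 𝕜 X x) fun φ => by
      obtain ⟨C, hC⟩ := (IsCompact.image hM (continuous_weakSpace_dual φ)).isBounded.exists_norm_le
      exact ⟨C, fun x => hC _ ⟨toWeakSpace 𝕜 X x, subset_closure (mem_image_of_mem _ x.2), rfl⟩⟩
  refine isBounded_iff_forall_norm_le.2 ⟨C, fun x hx => ?_⟩
  rw [← (NormedSpace.inclusionInDoubleDualLi (E := X) 𝕜).norm_map x]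
  exact hC ⟨x, hx⟩

/-- **Grothendieck's lemma**: a set approximated in norm by relatively weakly compact sets is
relatively weakly compact. In the bidual, the weak-* closure of `M` lies within each `ε` of `X`. -/
theorem RelWeaklyCompact.of_approx [CompleteSpace X] {M : Set X}
    (h : ∀ ε : ℝ, 0 < ε → ∃ N : Set X, RelWeaklyCompact 𝕜 N ∧ ∀ x ∈ M, ∃ y ∈ N, ‖x - y‖ ≤ ε) :
    RelWeaklyCompact 𝕜 M := by
  refine NormedSpace.isCompact_closure_of_isBounded 𝕜 X _ ?_ ?_
  · obtain ⟨N, hN, hMN⟩ := h 1 one_pos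
    obtain ⟨C, hC⟩ := hN.isBounded.exists_norm_le
    rw [preimage_image_eq _ (toWeakSpace 𝕜 X).injective]
    refine isBounded_iff_forall_norm_le.2 ⟨C + 1, fun x hx => ?_⟩
    obtain ⟨y, hy, hxy⟩ := hMN x hx
    have h1 := norm_le_norm_add_norm_sub' x y
    linarith [hC y hy]
  · intro Λ hΛ
    let J := NormedSpace.inclusionInDoubleDualLi (E := X) 𝕜
    have hcl : IsClosed (range J) := J.isometry.isUniformInducing.isComplete_range.isClosed
    suffices hmem : WeakDual.toStrongDual Λ ∈ range J by
      obtain ⟨x, hx⟩ := hmem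
      exact ⟨toWeakSpace 𝕜 X x, WeakDual.toStrongDual.injective hx⟩
    rw [← hcl.closure_eq]
    refine (Metric.mem_closure_iff (α := StrongDual 𝕜 (StrongDual 𝕜 X))).2 fun ε hε => ?_
    obtain ⟨N, hN, hMN⟩ := h (ε / 2) (half_pos hε)
    have hK := (IsCompact.image hN (NormedSpace.inclusionInDoubleDualWeak 𝕜 X).continuous).add
      (WeakDual.isCompact_closedBall (𝕜 := 𝕜) (E := StrongDual 𝕜 X) 0 (ε / 2))
    have hsub : closure (NormedSpace.inclusionInDoubleDualWeak 𝕜 X '' (toWeakSpace 𝕜 X '' M)) ⊆ _ :=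
      closure_minimal (by
        rintro _ ⟨_, ⟨x, hx, rfl⟩, rfl⟩
        obtain ⟨y, hy, hxy⟩ := hMN x hx
        refine ⟨_, ⟨_, subset_closure (mem_image_of_mem _ hy), rfl⟩,
          NormedSpace.inclusionInDoubleDualWeak 𝕜 X (toWeakSpace 𝕜 X (x - y)), ?_, ?_⟩
        · rw [mem_preimage, mem_closedBall_zero_iff]
          exact ((J.norm_map (x - y)).le).trans hxy
        · change _ + _ = _
          rw [← map_add, ← map_add, add_sub_cancel]) hK.isClosed
    obtain ⟨_, ⟨y, -, rfl⟩, r, hr, rfl⟩ := hsub hΛ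
    refine ⟨_, mem_range_self ((toWeakSpace 𝕜 X).symm y), ?_⟩
    rw [mem_preimage, mem_closedBall_zero_iff] at hr
    rw [map_add]
    refine (dist_eq_norm (E := StrongDual 𝕜 (StrongDual 𝕜 X)) _ _).trans_lt ?_
    refine (congrArg norm (add_sub_cancel_left (J ((toWeakSpace 𝕜 X).symm y))
      (WeakDual.toStrongDual r))).trans_lt ?_
    linarith

/-- In a relatively compact set weakly Cauchy sequences converge weakly. -/
theorem relWeaklySeqComplete_of_isCompact_closure {M : Set X} (hM : IsCompact (closure M)) :
    RelWeaklySeqComplete 𝕜 M := by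
  intro x hx hc
  obtain ⟨a, -, n, hn, ha⟩ := hM.tendsto_subseq fun k => subset_closure (hx k)
  refine ⟨a, fun φ => tendsto_nhds_of_cauchySeq_of_subseq (hc φ) hn.tendsto_atTop ?_⟩
  exact (φ.continuous.tendsto a).comp ha

variable [NormedSpace ℝ X] [IsScalarTower ℝ 𝕜 X]

/-- A function with separable range is strongly measurable if closed balls have measurable
preimages. -/
theorem stronglyMeasurable_of_closedBall {α E : Type*} [MeasurableSpace α] [NormedAddCommGroup E]
    {j : α → E} (hsep : TopologicalSpace.IsSeparable (range j))
    (hj : ∀ c r, MeasurableSet (j ⁻¹' Metric.closedBall c r)) : StronglyMeasurable j := by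
  let _ : MeasurableSpace E := borel E
  have : BorelSpace E := ⟨rfl⟩
  refine stronglyMeasurable_iff_measurable_separable.2 ⟨measurable_of_isOpen fun U hU => ?_, hsep⟩
  obtain ⟨D, hD, hjD⟩ := hsep
  have : j ⁻¹' U = ⋃ p ∈ {p : E × ℚ | p.1 ∈ D ∧ Metric.closedBall p.1 p.2 ⊆ U},
      j ⁻¹' Metric.closedBall p.1 p.2 := by
    ext k
    simp only [mem_preimage, mem_iUnion, exists_prop]
    refine ⟨fun hk => ?_, fun ⟨p, hp, hk⟩ => hp.2 hk⟩
    obtain ⟨r, hr, hrU⟩ := Metric.isOpen_iff.1 hU _ hk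
    obtain ⟨d, hd, hkd⟩ := Metric.mem_closure_iff.1 (hjD (mem_range_self k)) (r / 3) (by linarith)
    obtain ⟨q, hq, hq'⟩ := exists_rat_btwn (show r / 3 < r / 2 by linarith)
    refine ⟨(d, q), ⟨hd, fun y hy => hrU ?_⟩, ?_⟩
    · rw [Metric.mem_closedBall] at hy
      rw [Metric.mem_ball]
      dsimp only at hy
      linarith [dist_triangle y d (j k), dist_comm d (j k)]
    · rw [Metric.mem_closedBall]
      dsimp only
      linarith
  rw [this]
  refine MeasurableSet.biUnion ?_ fun p _ => hj _ _
  refine (hD.prod (countable_univ (α := ℚ))).mono ?_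
  rintro ⟨d, q⟩ hp
  exact ⟨hp.1, mem_univ _⟩

/-- **Krein's theorem** for integral means: the barycenters of the probability measures on a weakly
compact, norm-separable set form a weakly compact set, because these measures form a compact space
and the barycenter depends continuously on them. -/
theorem RelWeaklyCompact.range_integral [CompleteSpace X] {f : ℝ → X} (hf : Continuous f)
    (hrwc : RelWeaklyCompact 𝕜 (range f)) {h : ℝ} (hh : 0 < h) :
    RelWeaklyCompact 𝕜 (range fun t => ∫ s in (0 : ℝ)..h, f (t + s)) := by
  let K : Set (WeakSpace 𝕜 X) := closure (toWeakSpace 𝕜 X '' range f)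
  have : CompactSpace K := isCompact_iff_compactSpace.1 hrwc
  let _ : MeasurableSpace K := borel K
  have : BorelSpace K := ⟨rfl⟩
  let j : K → X := fun k => (toWeakSpace 𝕜 X).symm k
  have hclosed {s : Set X} (hs : Convex ℝ s) (hc : IsClosed s) : IsClosed (j ⁻¹' s) := by
    have h1 := (isClosed_toWeakSpace_image (𝕜 := 𝕜) hs hc).preimage
      (continuous_subtype_val (p := (· ∈ K)))
    convert h1 using 1
    ext k
    simp only [mem_preimage, j]
    exact ⟨fun hk => ⟨_, hk, by simp⟩, fun ⟨x, hx, hxk⟩ => by simpa [← hxk] using hx⟩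
  have hjmem {s : Set X} (hs : Convex ℝ s) (hc : IsClosed s) (hfs : range f ⊆ s) (k : K) :
      j k ∈ s := by
    obtain ⟨x, hx, hxk⟩ := closure_minimal (image_mono hfs)
      (isClosed_toWeakSpace_image (𝕜 := 𝕜) hs hc) k.2
    simpa [j, ← hxk] using hx
  have hsep : TopologicalSpace.IsSeparable (range j) := by
    have h1 := (TopologicalSpace.isSeparable_range hf).span (R := ℝ)
    refine h1.closure.mono ?_
    rintro _ ⟨k, rfl⟩
    exact hjmem (Submodule.convex _).closure isClosed_closure
      (Submodule.subset_span.trans subset_closure) k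
  have hjm : StronglyMeasurable j := stronglyMeasurable_of_closedBall hsep fun c r =>
    (hclosed (convex_closedBall c r) Metric.isClosed_closedBall).measurableSet
  obtain ⟨B, hB⟩ := hrwc.isBounded.subset_closedBall 0
  have hjB (k : K) : ‖j k‖ ≤ B := by
    simpa using hjmem (convex_closedBall (0 : X) B) Metric.isClosed_closedBall hB k
  have hint (μ : Measure K) [IsProbabilityMeasure μ] : Integrable j μ :=
    Integrable.of_bound hjm.aestronglyMeasurable B (Eventually.of_forall hjB)
  -- the barycenter map is continuous on the compact space of probability measures
  have hβ : Continuous fun μ : ProbabilityMeasure K => toWeakSpace 𝕜 X (∫ k, j k ∂(μ : Measure K)) := by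
    refine continuous_iff_continuousAt.2 fun μ₀ => tendsto_toWeakSpace_iff.2 fun φ => ?_
    let g : BoundedContinuousFunction K 𝕜 := BoundedContinuousFunction.mkOfCompact
      ⟨fun k => φ (j k), (continuous_weakSpace_dual φ).comp continuous_subtype_val⟩
    have h1 := (ProbabilityMeasure.tendsto_iff_forall_integral_rclike_tendsto 𝕜).1
      (tendsto_id (x := 𝓝 μ₀)) g
    have h2 (μ : ProbabilityMeasure K) : ∫ k, g k ∂(μ : Measure K) = φ (∫ k, j k ∂(μ : Measure K)) :=
      φ.integral_comp_comm (hint _)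
    simp only [h2] at h1
    exact h1
  have hC := isCompact_range hβ
  have hmean : RelWeaklyCompact 𝕜 (range fun t => h⁻¹ • ∫ s in (0 : ℝ)..h, f (t + s)) := by
    refine .of_subset hC ?_
    rintro _ ⟨_, ⟨t, rfl⟩, rfl⟩
    let ν : Measure ℝ := (ENNReal.ofReal h)⁻¹ • volume.restrict (Ioc 0 h)
    have hν : IsProbabilityMeasure ν := ⟨by
      simp only [ν, Measure.smul_apply, Measure.restrict_apply_univ, Real.volume_Ioc, sub_zero,
        smul_eq_mul]
      exact ENNReal.inv_mul_cancel (by simpa using hh) ENNReal.ofReal_ne_top⟩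
    let F : ℝ → K := fun s =>
      ⟨toWeakSpace 𝕜 X (f (t + s)), subset_closure (mem_image_of_mem _ (mem_range_self _))⟩
    have hF : Continuous F := Continuous.subtype_mk ((toWeakSpaceCLM 𝕜 X).continuous.comp
      (hf.comp (continuous_const.add continuous_id))) _
    refine ⟨⟨ν.map F, Measure.isProbabilityMeasure_map hF.measurable.aemeasurable⟩, ?_⟩
    dsimp only [ProbabilityMeasure.coe_mk]
    rw [integral_map hF.measurable.aemeasurable hjm.aestronglyMeasurable, integral_smul_measure,
      intervalIntegral.integral_of_le hh.le]
    simp [ENNReal.toReal_ofReal hh.le, j, F]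
  refine (hmean.smul (h : 𝕜)).mono ?_
  rintro _ ⟨t, rfl⟩
  refine ⟨_, mem_range_self t, ?_⟩
  change (h : 𝕜) • h⁻¹ • _ = _
  rw [← RCLike.real_smul_eq_coe_smul (K := 𝕜), smul_inv_smul₀ hh.ne']

end

/-! ### Ranges of recurrent functions with small differences -/

section

variable {X : Type*} [NormedAddCommGroup X]

theorem diff_neg (h : ℝ) (f : ℝ → X) (t : ℝ) : diff (-h) f t = -diff h f (t - h) := by
  simp [diff, sub_eq_add_neg]

theorem diff_add (h k : ℝ) (f : ℝ → X) (t : ℝ) :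
    diff (h + k) f t = diff k f (t + h) + diff h f t := by
  simp [diff, add_assoc]

theorem diff_diff_comm (h s : ℝ) (f : ℝ → X) (t : ℝ) :
    diff s f (t + h) - diff s f t = diff h f (t + s) - diff h f t := by
  simp only [diff, add_right_comm t h s]
  abel

/-- For a recurrent function finitely many translates of a set of return times cover `ℝ`: near `0`
the function is almost constant, so the return times may be thickened. -/
theorem IsRecurrent.exists_finset_return {F : ℝ → X} (hF : IsRecurrent F) {ε : ℝ} (hε : 0 < ε) :
    ∃ S : Finset ℝ, ∀ t, ∃ l ∈ S, ‖F (t - l) - F 0‖ ≤ ε := by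
  obtain ⟨L, hL, hEL⟩ := hF.2 (Icc 0 1) isCompact_Icc (ε / 2) (half_pos hε)
  obtain ⟨δ, hδ, hFδ⟩ := Metric.continuous_iff.1 hF.1 0 (ε / 2) (half_pos hε)
  set η := min δ 1 with hη
  have hη0 : 0 < η := lt_min hδ one_pos
  obtain ⟨S, hS⟩ := hL.elim_finite_subcover (fun c : ℝ => Ioo c (c + η)) (fun c => isOpen_Ioo)
    (fun x _ => mem_iUnion.2 ⟨x - η / 2, by constructor <;> linarith⟩)
  refine ⟨S, fun t => ?_⟩
  obtain ⟨τ, hτ, l, hl, rfl⟩ : t ∈ periods F (ε / 2) (Icc 0 1) + L := hEL ▸ mem_univ t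
  obtain ⟨c, hc, hlc⟩ := mem_iUnion₂.1 (hS hl)
  refine ⟨c, hc, ?_⟩
  have h1 := hτ (l - c) ⟨by linarith [hlc.1], by linarith [hlc.2, min_le_right δ 1]⟩
  have h2 := hFδ (l - c) (by
    rw [Real.dist_eq, sub_zero, abs_of_pos (by linarith [hlc.1])]
    linarith [hlc.2, min_le_left δ 1])
  rw [dist_eq_norm] at h2
  have h3 : (fun x1 x2 => x1 + x2) τ l - c = l - c + τ := by ring
  rw [h3]
  have h4 := norm_add_le (F (l - c + τ) - F (l - c)) (F (l - c) - F 0)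
  rw [sub_add_sub_cancel] at h4
  linarith

/-- If a notion `P` of smallness of sets is stable under subsets, differences, finite unions and
uniform approximation, a recurrent function with small ranges of differences has small range. -/
theorem IsRecurrent.range_of_diff {F : ℝ → X} (hF : IsRecurrent F) {P : Set X → Prop}
    (singleton : ∀ x, P {x}) (sub : ∀ {M N}, P M → P N → P (M - N))
    (biUnion : ∀ (S : Finset ℝ) {M : ℝ → Set X}, (∀ i ∈ S, P (M i)) → P (⋃ i ∈ S, M i))
    (mono : ∀ {M N : Set X}, P N → M ⊆ N → P M)
    (approx : ∀ {M : Set X}, (∀ ε : ℝ, 0 < ε → ∃ N : Set X, P N ∧ ∀ x ∈ M, ∃ y ∈ N, ‖x - y‖ ≤ ε) →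
      P M)
    (hd : ∀ h : ℝ, 0 < h → P (range (diff h F))) : P (range F) := by
  have hd' (h : ℝ) : P (range (diff h F)) := by
    rcases lt_trichotomy h 0 with hh | rfl | hh
    · refine mono (sub (singleton 0) (hd (-h) (by linarith))) ?_
      rintro _ ⟨t, rfl⟩
      refine ⟨0, rfl, _, mem_range_self (t + h), ?_⟩
      have := diff_neg (-h) F t
      rw [neg_neg] at this
      rw [this]
      simp
    · refine mono (singleton 0) ?_
      rintro _ ⟨t, rfl⟩
      simp [diff]
    · exact hd h hh
  refine approx fun ε hε => ?_
  obtain ⟨S, hS⟩ := hF.exists_finset_return hε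
  refine ⟨_, sub (biUnion S fun l _ => hd' l) (singleton (-F 0)), ?_⟩
  rintro _ ⟨t, rfl⟩
  obtain ⟨l, hl, hle⟩ := hS t
  refine ⟨diff l F (t - l) - -F 0, sub_mem_sub (mem_iUnion₂.2 ⟨l, hl, mem_range_self _⟩) rfl, ?_⟩
  convert hle using 2
  simp only [diff, sub_add_cancel]
  abel

/-! ### Relatively compact sets -/

theorem isCompact_closure_sub {M N : Set X} (hM : IsCompact (closure M))
    (hN : IsCompact (closure N)) : IsCompact (closure (M - N)) := by
  refine ((hM.prod hN).image continuous_sub).closure_of_subset ?_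
  rintro _ ⟨x, hx, y, hy, rfl⟩
  exact ⟨(x, y), ⟨subset_closure hx, subset_closure hy⟩, rfl⟩

theorem isCompact_closure_biUnion {ι : Type*} (S : Finset ι) {M : ι → Set X}
    (hM : ∀ i ∈ S, IsCompact (closure (M i))) : IsCompact (closure (⋃ i ∈ S, M i)) :=
  (S.isCompact_biUnion hM).closure_of_subset (iUnion₂_mono fun _ _ => subset_closure)

theorem isCompact_closure_iff_totallyBounded [CompleteSpace X] {M : Set X} :
    IsCompact (closure M) ↔ TotallyBounded M :=
  ⟨fun h => h.totallyBounded.subset subset_closure,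
    fun h =>
      isCompact_iff_totallyBounded_isComplete.2 ⟨h.closure, isClosed_closure.isComplete⟩⟩

theorem isCompact_closure_of_approx [CompleteSpace X] {M : Set X}
    (h : ∀ ε : ℝ, 0 < ε → ∃ N : Set X, IsCompact (closure N) ∧ ∀ x ∈ M, ∃ y ∈ N, ‖x - y‖ ≤ ε) :
    IsCompact (closure M) := by
  rw [isCompact_closure_iff_totallyBounded, Metric.totallyBounded_iff]
  intro ε hε
  obtain ⟨N, hN, hMN⟩ := h (ε / 2) (half_pos hε)
  obtain ⟨S, hS, hNS⟩ := Metric.totallyBounded_iff.1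
    (isCompact_closure_iff_totallyBounded.1 hN) (ε / 2) (half_pos hε)
  refine ⟨S, hS, fun x hx => ?_⟩
  obtain ⟨y, hy, hxy⟩ := hMN x hx
  obtain ⟨z, hz, hyz⟩ := mem_iUnion₂.1 (hNS hy)
  refine mem_iUnion₂.2 ⟨z, hz, ?_⟩
  rw [← dist_eq_norm] at hxy
  rw [Metric.mem_ball] at hyz ⊢
  linarith [dist_triangle x y z]

/-! ### Uniformity of the differences on bounded intervals of steps -/

/-- Baire's theorem for properties of the step: if the steps are exhausted by closed sets `H n`, the
differences with steps in `[0, k]` are combinations of those with steps in one `H n` and finitely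
many others. -/
theorem exists_diff_decomposition (f : ℝ → X) {H : ℕ → Set ℝ} (hc : ∀ n, IsClosed (H n))
    (hH : ⋃ n, H n = univ) (k : ℝ) :
    ∃ n a, ∃ S : Finset ℝ, ∀ h ∈ Icc 0 k, ∃ i ∈ S, ∃ r ∈ H n, ∀ t,
      diff h f t = diff r f (t + (i - a)) - diff a f (t + (i - a)) + diff i f t := by
  obtain ⟨n, x, hx⟩ := nonempty_interior_of_iUnion_of_closed hc hH
  obtain ⟨a, b, hab, habH⟩ := mem_nhds_iff_exists_Ioo_subset.1 (mem_interior_iff_mem_nhds.1 hx)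
  set η := (b - x) / 2 with hη
  have hη0 : 0 < η := by linarith [hab.2]
  obtain ⟨N, hN⟩ := exists_nat_ge (k / η)
  rw [div_le_iff₀ hη0] at hN
  refine ⟨n, x, (Finset.range (N + 1)).image fun i : ℕ => (i : ℝ) * η, fun h hh => ?_⟩
  set i := ⌊h / η⌋₊ with hi
  have h1 : (i : ℝ) ≤ h / η := Nat.floor_le (div_nonneg hh.1 hη0.le)
  have h2 : h / η < i + 1 := Nat.lt_floor_add_one _
  rw [le_div_iff₀ hη0] at h1
  rw [div_lt_iff₀ hη0] at h2
  have h3 : (i : ℝ) * η ≤ N * η := by linarith [hh.2]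
  have h4 : i ≤ N := by exact_mod_cast le_of_mul_le_mul_right h3 hη0
  refine ⟨i * η, Finset.mem_image_of_mem _ (Finset.mem_range.2 (by omega)), x + (h - i * η),
    habH ⟨by linarith [hab.1], by linarith⟩, fun t => ?_⟩
  simp only [diff]
  have e1 : t + (i * η - x) + (x + (h - i * η)) = t + h := by ring
  have e2 : t + (i * η - x) + x = t + i * η := by ring
  rw [e1, e2]
  abel

theorem continuous_diff_step {f : ℝ → X} (hf : Continuous f) (t : ℝ) :
    Continuous fun h => diff h f t := by
  unfold diff
  fun_prop

theorem continuous_diff {f : ℝ → X} (hf : Continuous f) (h : ℝ) : Continuous (diff h f) := by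
  unfold diff
  fun_prop

/-- Bounded differences are uniformly bounded for steps in bounded intervals. -/
theorem exists_norm_diff_le {f : ℝ → X} (hf : Continuous f)
    (hd : ∀ h, Bornology.IsBounded (range (diff h f))) (k : ℝ) :
    ∃ C, ∀ h ∈ Icc 0 k, ∀ t, ‖diff h f t‖ ≤ C := by
  choose B hB using fun h => (hd h).exists_norm_le
  replace hB (h t : ℝ) : ‖diff h f t‖ ≤ B h := hB h _ (mem_range_self t)
  have hB0 (h : ℝ) : 0 ≤ B h := (norm_nonneg _).trans (hB h 0)
  obtain ⟨n, a, S, hS⟩ := exists_diff_decomposition f (H := fun n : ℕ => {h | ∀ t, ‖diff h f t‖ ≤ n})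
    (fun n => by
      rw [ofPred_forall]
      exact isClosed_iInter fun t =>
        isClosed_le (continuous_diff_step hf t).norm continuous_const)
    (eq_univ_of_forall fun h => by
      obtain ⟨n, hn⟩ := exists_nat_ge (B h)
      exact mem_iUnion.2 ⟨n, fun t => (hB h t).trans hn⟩) k
  refine ⟨n + B a + ∑ i ∈ S, B i, fun h hh t => ?_⟩
  obtain ⟨i, hi, r, hr, he⟩ := hS h hh
  rw [he]
  have h1 := Finset.single_le_sum (fun i _ => hB0 i) hi
  have h2 := norm_add_le (diff r f (t + (i - a)) - diff a f (t + (i - a))) (diff i f t)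
  have h3 := norm_sub_le (diff r f (t + (i - a))) (diff a f (t + (i - a)))
  linarith [hr (t + (i - a)), hB a (t + (i - a)), hB i t]

theorem uniformContinuous_of_forall_le {f : ℝ → X}
    (h : ∀ ε : ℝ, 0 < ε → ∃ δ : ℝ, 0 < δ ∧ ∀ s ∈ Icc 0 δ, ∀ t, ‖f (t + s) - f t‖ ≤ ε) :
    UniformContinuous f := by
  refine Metric.uniformContinuous_iff.2 fun ε hε => ?_
  obtain ⟨δ, hδ, hs⟩ := h (ε / 2) (half_pos hε)
  refine ⟨δ, hδ, fun {a b} hab => ?_⟩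
  rw [Real.dist_eq] at hab
  have hab' := abs_lt.1 hab
  rw [dist_eq_norm]
  rcases le_total a b with hle | hle
  · have := hs (b - a) ⟨by linarith, by linarith⟩ a
    rw [add_sub_cancel, norm_sub_rev] at this
    linarith
  · have := hs (a - b) ⟨by linarith, by linarith⟩ b
    rw [add_sub_cancel] at this
    linarith

theorem exists_forall_le_of_uniformContinuous {f : ℝ → X} (hf : UniformContinuous f) {ε : ℝ}
    (hε : 0 < ε) : ∃ δ : ℝ, 0 < δ ∧ ∀ s ∈ Icc 0 δ, ∀ t, ‖f (t + s) - f t‖ ≤ ε := by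
  obtain ⟨δ, hδ, h⟩ := Metric.uniformContinuous_iff.1 hf ε hε
  refine ⟨δ / 2, half_pos hδ, fun s hs t => ?_⟩
  have := h (a := t + s) (b := t) (by
    rw [Real.dist_eq, add_sub_cancel_left, abs_of_nonneg hs.1]
    linarith [hs.2])
  rw [dist_eq_norm] at this
  exact this.le

/-- Uniformly continuous differences are equi-uniformly continuous for steps in bounded
intervals. -/
theorem exists_modulus_diff {f : ℝ → X} (hf : Continuous f)
    (hd : ∀ h, UniformContinuous (diff h f)) (k : ℝ) {ε : ℝ} (hε : 0 < ε) :
    ∃ δ : ℝ, 0 < δ ∧ ∀ h ∈ Icc 0 k, ∀ s ∈ Icc 0 δ, ∀ t, ‖diff h f (t + s) - diff h f t‖ ≤ ε := by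
  choose δ hδ hδ' using fun h => exists_forall_le_of_uniformContinuous (hd h)
    (show (0 : ℝ) < ε / 3 by linarith)
  obtain ⟨n, a, S, hS⟩ := exists_diff_decomposition f
    (H := fun n : ℕ => {h | ∀ s ∈ Icc (0 : ℝ) (1 / (n + 1)), ∀ t,
      ‖diff h f (t + s) - diff h f t‖ ≤ ε / 3})
    (fun n => by
      simp only [ofPred_forall]
      exact isClosed_iInter fun s => isClosed_iInter fun _ => isClosed_iInter fun t =>
        isClosed_le ((continuous_diff_step hf _).sub (continuous_diff_step hf _)).norm
          continuous_const)
    (eq_univ_of_forall fun h => by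
      obtain ⟨n, hn⟩ := exists_nat_one_div_lt (hδ h)
      exact mem_iUnion.2 ⟨n, fun s hs => hδ' h s ⟨hs.1, hs.2.trans hn.le⟩⟩) k
  obtain ⟨δ₀, hδ₀, hδS⟩ : ∃ δ₀ : ℝ, 0 < δ₀ ∧ ∀ i ∈ S, δ₀ ≤ δ i := by
    rcases S.eq_empty_or_nonempty with rfl | hne
    · exact ⟨1, one_pos, by simp⟩
    · obtain ⟨i, _, hi'⟩ := S.exists_min_image δ hne
      exact ⟨δ i, hδ i, hi'⟩
  refine ⟨min (min δ₀ (δ a)) (1 / (n + 1)), lt_min (lt_min hδ₀ (hδ a)) (by positivity), ?_⟩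
  intro h hh s hs t
  obtain ⟨i, hi, r, hr, he⟩ := hS h hh
  have hs1 : s ∈ Icc 0 (δ i) :=
    ⟨hs.1, hs.2.trans ((min_le_left _ _).trans ((min_le_left _ _).trans (hδS i hi)))⟩
  have hs2 : s ∈ Icc 0 (δ a) := ⟨hs.1, hs.2.trans ((min_le_left _ _).trans (min_le_right _ _))⟩
  have hs3 : s ∈ Icc (0 : ℝ) (1 / (n + 1)) := ⟨hs.1, hs.2.trans (min_le_right _ _)⟩
  rw [he, he, add_right_comm t s (i - a)]
  set u := t + (i - a)
  have h1 := hr s hs3 u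
  have h2 := hδ' a s hs2 u
  have h3 := hδ' i s hs1 t
  have h4 := norm_add_le (diff r f (u + s) - diff r f u - (diff a f (u + s) - diff a f u))
    (diff i f (t + s) - diff i f t)
  have h5 := norm_sub_le (diff r f (u + s) - diff r f u) (diff a f (u + s) - diff a f u)
  have h6 : diff r f (u + s) - diff a f (u + s) + diff i f (t + s) -
      (diff r f u - diff a f u + diff i f t) =
      (diff r f (u + s) - diff r f u - (diff a f (u + s) - diff a f u)) +
      (diff i f (t + s) - diff i f t) := by abel
  rw [h6]
  linarith

/-- Differences with relatively compact ranges take their values in one relatively compact set for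
all steps in a bounded interval. -/
theorem isCompact_closure_diff_Icc [CompleteSpace X] {f : ℝ → X} (hf : Continuous f)
    (hd : ∀ h, IsCompact (closure (range (diff h f)))) (k : ℝ) :
    IsCompact (closure {x | ∃ h ∈ Icc 0 k, ∃ t, diff h f t = x}) := by
  refine isCompact_closure_of_approx fun ε hε => ?_
  let p : ℕ → ℝ × ℝ := TopologicalSpace.denseSeq (ℝ × ℝ)
  let d : ℕ → X := fun m => diff (p m).1 f (p m).2
  have hjoint : Continuous fun q : ℝ × ℝ => diff q.1 f q.2 := by unfold diff; fun_prop
  obtain ⟨n, a, S, hS⟩ := exists_diff_decomposition f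
    (H := fun n : ℕ => {h | ∀ t, diff h f t ∈ ⋃ m ∈ Finset.range n, Metric.closedBall (d m) ε})
    (fun n => by
      rw [ofPred_forall]
      exact isClosed_iInter fun t => IsClosed.preimage (continuous_diff_step hf t)
        (Set.Finite.isClosed_biUnion (Finset.finite_toSet _) fun m _ => Metric.isClosed_closedBall))
    (eq_univ_of_forall fun h => by
      obtain ⟨T, hT⟩ := (hd h).elim_finite_subcover (fun m => Metric.ball (d m) ε)
        (fun m => Metric.isOpen_ball) (fun x hx => by
          obtain ⟨_, ⟨t, rfl⟩, ht⟩ := Metric.mem_closure_iff.1 hx (ε / 2) (half_pos hε)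
          obtain ⟨_, hq, ⟨m, rfl⟩⟩ := (TopologicalSpace.denseRange_denseSeq (ℝ × ℝ)).inter_open_nonempty
            _ (Metric.isOpen_ball.preimage hjoint (t := Metric.ball (diff h f t) (ε / 2)))
            ⟨(h, t), by simpa using hε⟩
          have hq' : dist (d m) (diff h f t) < ε / 2 := hq
          refine mem_iUnion.2 ⟨m, ?_⟩
          rw [Metric.mem_ball]
          linarith [dist_triangle x (diff h f t) (d m), dist_comm (d m) (diff h f t)])
      obtain ⟨n, hn⟩ := T.exists_nat_subset_range
      refine mem_iUnion.2 ⟨n, fun t => ?_⟩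
      obtain ⟨m, hm, hmt⟩ := mem_iUnion₂.1 (hT (subset_closure (mem_range_self t)))
      exact mem_iUnion₂.2 ⟨m, hn hm, Metric.ball_subset_closedBall hmt⟩) k
  refine ⟨_, isCompact_closure_sub (isCompact_closure_biUnion S fun i _ => hd i)
    (isCompact_closure_sub (hd a) (M := range (diff a f))
      (N := d '' (Finset.range n : Set ℕ)) ?_), ?_⟩
  · exact ((Finset.finite_toSet _).image d).isCompact.closure
  · rintro _ ⟨h, hh, t, rfl⟩
    obtain ⟨i, hi, r, hr, he⟩ := hS h hh
    obtain ⟨m, hm, hmr⟩ := mem_iUnion₂.1 (hr (t + (i - a)))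
    refine ⟨_, sub_mem_sub (mem_iUnion₂.2 ⟨i, hi, mem_range_self t⟩)
      (sub_mem_sub (mem_range_self (t + (i - a))) (mem_image_of_mem d hm)), ?_⟩
    rw [Metric.mem_closedBall, dist_eq_norm] at hmr
    rw [he]
    refine (congrArg norm ?_).trans_le hmr
    abel

end

/-! ### Means -/

section

variable {X : Type*} [NormedAddCommGroup X]

theorem intervalIntegrable_comp_add {f : ℝ → X} (hf : Continuous f) (t a b : ℝ) :
    IntervalIntegrable (fun s => f (t + s)) volume a b :=
  (hf.comp (continuous_const.add continuous_id)).intervalIntegrable a b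

variable [NormedSpace ℝ X]

theorem continuous_mean {f : ℝ → X} (hf : Continuous f) (k : ℝ) : Continuous (mean k f) :=
  (intervalIntegral.continuous_parametric_intervalIntegral_of_continuous' (by fun_prop) _ _).const_smul _

theorem mean_sub_mean {f g : ℝ → X} (hf : Continuous f) (hg : Continuous g) (k t : ℝ) :
    mean k f t - mean k g t = mean k (fun s => f s - g s) t := by
  simp only [mean]
  rw [← smul_sub, ← intervalIntegral.integral_sub (intervalIntegrable_comp_add hf _ _ _)
    (intervalIntegrable_comp_add hg _ _ _)]

theorem norm_inv_smul_integral_le {g : ℝ → X} {k C : ℝ} (hk : 0 < k)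
    (hg : ∀ s ∈ Icc 0 k, ‖g s‖ ≤ C) : ‖k⁻¹ • ∫ s in (0 : ℝ)..k, g s‖ ≤ C := by
  have h1 := intervalIntegral.norm_integral_le_of_norm_le_const (a := 0) (b := k) (f := g) (C := C)
    (fun s hs => hg s (by rw [uIoc_of_le hk.le] at hs; exact ⟨hs.1.le, hs.2⟩))
  rw [sub_zero, abs_of_pos hk] at h1
  rw [norm_smul, norm_inv, Real.norm_of_nonneg hk.le, inv_mul_le_iff₀ hk, mul_comm]
  exact h1

theorem mean_shift (f : ℝ → X) (k h t : ℝ) : mean k f (t + h) = mean k (fun s => f (s + h)) t := by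
  simp only [mean, add_right_comm t h]

theorem norm_mean_shift_sub_le {f : ℝ → X} (hf : Continuous f) {k τ t C : ℝ} (hk : 0 < k)
    (h : ∀ s ∈ Icc 0 k, ‖f (t + s + τ) - f (t + s)‖ ≤ C) :
    ‖mean k f (t + τ) - mean k f t‖ ≤ C := by
  rw [mean_shift, mean_sub_mean (by fun_prop) hf]
  exact norm_inv_smul_integral_le hk h

theorem RecAlong.mean {l : Filter ℝ} {f : ℝ → X} (hr : RecAlong l f) (hf : Continuous f) {k : ℝ}
    (hk : 0 < k) : RecAlong l (mean k f) := by
  refine RecAlong.of_Icc fun R hR ε hε => ?_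
  filter_upwards [hr (Icc (-R) (R + k)) isCompact_Icc ε hε] with τ hτ t ht
  exact norm_mean_shift_sub_le hf hk fun s hs =>
    hτ (t + s) ⟨by linarith [ht.1, hs.1], by linarith [ht.2, hs.2]⟩

theorem RecAlong.const_smul {l : Filter ℝ} {f : ℝ → X} (hr : RecAlong l f) (c : ℝ) :
    RecAlong l fun t => c • f t := by
  intro K hK ε hε
  filter_upwards [hr K hK (ε / (|c| + 1)) (by positivity)] with τ hτ t ht
  rw [← smul_sub, norm_smul, Real.norm_eq_abs]
  calc |c| * ‖f (t + τ) - f t‖ ≤ (|c| + 1) * (ε / (|c| + 1)) := by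
        gcongr
        · linarith
        · exact hτ t ht
    _ = ε := by field_simp

theorem sub_mean_eq [CompleteSpace X] {f : ℝ → X} (hf : Continuous f) {k : ℝ} (hk : 0 < k) (t : ℝ) :
    f t - mean k f t = -(k⁻¹ • ∫ s in (0 : ℝ)..k, diff s f t) := by
  simp only [diff, mean]
  rw [intervalIntegral.integral_sub (intervalIntegrable_comp_add hf _ _ _)
    (continuous_const.intervalIntegrable _ _), smul_sub, intervalIntegral.integral_const, sub_zero,
    inv_smul_smul₀ hk.ne', neg_sub]

theorem diff_sub_mean {f : ℝ → X} (hf : Continuous f) (k h : ℝ) :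
    diff h (f - mean k f) = fun t => diff h f t - mean k (diff h f) t := by
  ext t
  simp only [diff, Pi.sub_apply]
  rw [mean_shift]
  have h1 := mean_sub_mean (f := fun s => f (s + h)) (by fun_prop) hf k t
  have h2 : mean k (fun s => diff h f s) t = mean k (fun s => f (s + h) - f s) t := rfl
  change _ = f (t + h) - f t - mean k (fun s => diff h f s) t
  rw [h2, ← h1]
  abel

theorem diff_prim {f : ℝ → X} (hf : Continuous f) {h : ℝ} (hh : 0 < h) :
    diff h (prim f) = fun t => h • mean h f t := by
  ext t
  simp only [diff, prim, mean]
  rw [smul_inv_smul₀ hh.ne', intervalIntegral.integral_interval_sub_left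
    (hf.intervalIntegrable _ _) (hf.intervalIntegrable _ _),
    intervalIntegral.integral_comp_add_left, add_zero]

theorem integral_diff_comm {f : ℝ → X} (hf : Continuous f) (k s t : ℝ) :
    ∫ h in (0 : ℝ)..k, diff s f (t + h) = ∫ v in (0 : ℝ)..s, diff k f (t + v) := by
  have e (a b : ℝ) : ∫ h in (0 : ℝ)..b, diff a f (t + h) =
      (∫ h in (t + a)..(t + b + a), f h) - ∫ h in t..(t + b), f h := by
    simp only [diff]
    rw [intervalIntegral.integral_sub ((by fun_prop : Continuous _).intervalIntegrable _ _)
      ((by fun_prop : Continuous _).intervalIntegrable _ _)]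
    congr 1
    · have := intervalIntegral.integral_comp_add_right (a := 0) (b := b) f (t + a)
      rw [zero_add] at this
      rw [add_right_comm t b a, add_comm (t + a) b, ← this]
      exact intervalIntegral.integral_congr fun h _ => by
        congr 1
        ring
    · rw [intervalIntegral.integral_comp_add_left, add_zero]
  rw [e, e, intervalIntegral.integral_interval_sub_interval_comm' (hf.intervalIntegrable _ _)
    (hf.intervalIntegrable _ _) (hf.intervalIntegrable _ _), add_right_comm]

variable [CompleteSpace X]

/-- If the difference of step `s` is nearly constant on `[t, t + k]` and the difference of step `k`
is bounded on `[t, t + s]`, then the difference of step `s` is small at `t`. -/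
theorem norm_diff_le_of_average {f : ℝ → X} (hf : Continuous f) {k s t ε C : ℝ} (hk : 0 < k)
    (hs : 0 ≤ s) (h1 : ∀ h ∈ Icc 0 k, ‖diff s f (t + h) - diff s f t‖ ≤ ε)
    (h2 : ∀ v ∈ Icc 0 s, ‖diff k f (t + v)‖ ≤ C) : ‖diff s f t‖ ≤ ε + C * s / k := by
  have hc (r : ℝ) : IntervalIntegrable (fun h => diff r f (t + h)) volume 0 k :=
    intervalIntegrable_comp_add (continuous_diff hf r) _ _ _
  have e : diff s f t = k⁻¹ • (∫ v in (0 : ℝ)..s, diff k f (t + v)) -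
      k⁻¹ • ∫ h in (0 : ℝ)..k, (diff s f (t + h) - diff s f t) := by
    rw [← integral_diff_comm hf, intervalIntegral.integral_sub (hc s)
      (continuous_const.intervalIntegrable _ _), smul_sub, intervalIntegral.integral_const, sub_zero,
      inv_smul_smul₀ hk.ne', sub_sub_cancel]
  have h3 := norm_inv_smul_integral_le hk h1
  have h4 := intervalIntegral.norm_integral_le_of_norm_le_const (a := 0) (b := s)
    (f := fun v => diff k f (t + v)) (C := C)
    (fun v hv => h2 v (by rw [uIoc_of_le hs] at hv; exact ⟨hv.1.le, hv.2⟩))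
  rw [sub_zero, abs_of_nonneg hs] at h4
  have h5 : ‖k⁻¹ • ∫ v in (0 : ℝ)..s, diff k f (t + v)‖ ≤ C * s / k := by
    rw [norm_smul, norm_inv, Real.norm_of_nonneg hk.le, inv_mul_eq_div]
    gcongr
  rw [e]
  exact (norm_sub_le _ _).trans (by linarith)

/-- A bounded function with uniformly continuous differences is uniformly continuous. -/
theorem uniformContinuous_of_diff {F : ℝ → X} (hF : F ∈ Cb X)
    (hd : ∀ h, UniformContinuous (diff h F)) : UniformContinuous F := by
  obtain ⟨B, hB⟩ := hF.2.exists_norm_le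
  replace hB (t : ℝ) : ‖F t‖ ≤ B := hB _ (mem_range_self t)
  have hB0 : 0 ≤ B := (norm_nonneg _).trans (hB 0)
  refine uniformContinuous_of_forall_le fun ε hε => ?_
  obtain ⟨δ, hδ, hs⟩ := exists_modulus_diff hF.1 hd 1 (half_pos hε)
  refine ⟨min δ (ε / 2 / (2 * B + 1)), lt_min hδ (by positivity), fun s hsδ t => ?_⟩
  have h1 := norm_diff_le_of_average hF.1 (k := 1) (s := s) (t := t) (ε := ε / 2) (C := 2 * B)
    one_pos hsδ.1 (fun h hh => by
      rw [diff_diff_comm]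
      exact hs h hh s ⟨hsδ.1, hsδ.2.trans (min_le_left _ _)⟩ t)
    (fun v _ => by
      have := norm_sub_le (F (t + v + 1)) (F (t + v))
      change ‖F (t + v + 1) - F (t + v)‖ ≤ _
      linarith [hB (t + v + 1), hB (t + v)])
  have h2 : s ≤ ε / 2 / (2 * B + 1) := hsδ.2.trans (min_le_right _ _)
  rw [le_div_iff₀ (by positivity)] at h2
  have h3 := hsδ.1
  change ‖diff s F t‖ ≤ ε
  linarith

/-- If all differences of `f` are uniformly continuous and recurrent along `l`, so is the
deviation of `f` from its mean, without any assumption on `X`: differences with small steps of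
`f (· + τ) - f` are small by averaging, so that finitely many steps control all of `[0, k]`. -/
theorem recAlong_sub_mean {l : Filter ℝ} {f : ℝ → X} (hf : Continuous f)
    (hu : ∀ h, UniformContinuous (diff h f)) (hd : ∀ h, RecAlong l (diff h f)) {k : ℝ}
    (hk : 0 < k) : RecAlong l (f - mean k f) := by
  refine RecAlong.of_Icc fun R hR ε hε => ?_
  obtain ⟨δ₀, hδ₀, hmod⟩ := exists_modulus_diff hf hu k (show 0 < ε / 4 by linarith)
  set δ := min δ₀ (ε * k / 4) with hδdef
  have hδ : 0 < δ := lt_min hδ₀ (by positivity)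
  obtain ⟨N, hN⟩ := exists_nat_ge (k / δ)
  rw [div_le_iff₀ hδ] at hN
  have hgrid : ∀ᶠ τ in l, ∀ i ∈ Finset.range (N + 1), ∀ t ∈ Icc (-R) R,
      ‖diff (i * δ) f (t + τ) - diff (i * δ) f t‖ ≤ ε / 4 :=
    (Filter.eventually_all_finset _).2 fun i _ => hd _ _ isCompact_Icc _ (by linarith)
  filter_upwards [hgrid, hd k (Icc (-R) (R + k + δ)) isCompact_Icc 1 one_pos] with τ hτ hτk t ht
  -- `φ` is the increment along `τ`
  set φ : ℝ → X := fun u => f (u + τ) - f u with hφ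
  have hφc : Continuous φ := by fun_prop
  have hφd (r u : ℝ) : diff r φ u = diff r f (u + τ) - diff r f u := by
    simp only [hφ, diff, add_right_comm u r τ]
    abel
  have hsmall : ∀ r ∈ Icc 0 δ, ∀ u ∈ Icc (-R) (R + k), ‖diff r φ u‖ ≤ 3 * (ε / 4) := by
    intro r hr u hu
    have h1 := norm_diff_le_of_average hφc (k := k) (s := r) (t := u) (ε := ε / 4 + ε / 4) (C := 1)
      hk hr.1 (fun h hh => by
        rw [diff_diff_comm, hφd, hφd]
        have hr' : r ∈ Icc 0 δ₀ := ⟨hr.1, hr.2.trans (min_le_left _ _)⟩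
        have e : diff h f (u + r + τ) - diff h f (u + r) - (diff h f (u + τ) - diff h f u) =
            (diff h f (u + τ + r) - diff h f (u + τ)) - (diff h f (u + r) - diff h f u) := by
          rw [add_right_comm u r τ]
          abel
        rw [e]
        exact (norm_sub_le _ _).trans (add_le_add (hmod h hh r hr' _) (hmod h hh r hr' _)))
      (fun v hv => by
        rw [hφd]
        exact hτk _ ⟨by linarith [hu.1, hv.1], by linarith [hu.2, hv.2, hr.2]⟩)
    have h2 : r ≤ ε * k / 4 := hr.2.trans (min_le_right _ _)
    have h3 : 1 * r / k ≤ ε / 4 := by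
      rw [div_le_iff₀ hk]
      linarith
    linarith
  have hall : ∀ s ∈ Icc 0 k, ‖diff s f (t + τ) - diff s f t‖ ≤ ε := by
    intro s hs
    set i := ⌊s / δ⌋₊ with hi
    have h1 : (i : ℝ) ≤ s / δ := Nat.floor_le (div_nonneg hs.1 hδ.le)
    have h2 : s / δ < i + 1 := Nat.lt_floor_add_one _
    rw [le_div_iff₀ hδ] at h1
    rw [div_lt_iff₀ hδ] at h2
    have h3 : (i : ℝ) * δ ≤ N * δ := by linarith [hs.2]
    have h4 : i ≤ N := by exact_mod_cast le_of_mul_le_mul_right h3 hδ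
    have h5 : (0 : ℝ) ≤ i * δ := by positivity
    have h6 : diff s φ t = diff (s - i * δ) φ (t + i * δ) + diff (i * δ) φ t := by
      rw [← diff_add, add_sub_cancel]
    have h7 := hsmall (s - i * δ) ⟨by linarith, by linarith⟩ (t + i * δ)
      ⟨by linarith [ht.1], by linarith [ht.2, hs.2]⟩
    have h8 := hτ i (Finset.mem_range.2 (by omega)) t ht
    rw [← hφd] at h8 ⊢
    rw [h6]
    exact (norm_add_le _ _).trans (by linarith)
  have hint (u : ℝ) : IntervalIntegrable (fun s => diff s f u) volume 0 k :=
    (continuous_diff_step hf u).intervalIntegrable _ _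
  rw [Pi.sub_apply, Pi.sub_apply, sub_mean_eq hf hk, sub_mean_eq hf hk, neg_sub_neg, norm_sub_rev,
    ← smul_sub, ← intervalIntegral.integral_sub (hint _) (hint _)]
  exact norm_inv_smul_integral_le hk hall

/-- Integral means of functions with values in one relatively compact set stay in the closed convex
hull, which is compact. -/
theorem isCompact_closure_range_mean {M : Set X} (hM : IsCompact (closure M)) {g : ℝ → ℝ → X}
    {k : ℝ} (hk : 0 < k) (hgc : ∀ t, Continuous (g t)) (hg : ∀ t, ∀ s ∈ Icc 0 k, g t s ∈ M) :
    IsCompact (closure (range fun t => k⁻¹ • ∫ s in (0 : ℝ)..k, g t s)) := by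
  have h1 : IsCompact (closure (closure (convexHull ℝ M))) := by
    rw [closure_closure, isCompact_closure_iff_totallyBounded, totallyBounded_convexHull]
    exact isCompact_closure_iff_totallyBounded.1 hM
  rw [closure_closure] at h1
  refine h1.closure_of_subset ?_
  rintro _ ⟨t, rfl⟩
  have h2 : ⨍ s in uIoc 0 k, g t s ∈ closure (convexHull ℝ M) := by
    rw [uIoc_of_le hk.le]
    refine (convex_convexHull ℝ M).set_average_mem_closure (by simpa using hk) (by simp) ?_ ?_
    · refine (ae_restrict_iff' measurableSet_Ioc).2 (Eventually.of_forall fun s hs => ?_)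
      exact subset_convexHull ℝ M (hg t s ⟨hs.1.le, hs.2⟩)
    · exact (intervalIntegrable_iff_integrableOn_Ioc_of_le hk.le).1
        ((hgc t).intervalIntegrable _ _)
  have h3 := interval_average_eq (g t) 0 k
  rw [sub_zero] at h3
  change k⁻¹ • _ ∈ _
  rw [← h3]
  exact h2

theorem sub_mean_mem_Cb {f : ℝ → X} (hf : Continuous f)
    (hd : ∀ h, Bornology.IsBounded (range (diff h f))) {k : ℝ} (hk : 0 < k) :
    f - mean k f ∈ Cb X := by
  obtain ⟨C, hC⟩ := exists_norm_diff_le hf hd k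
  refine ⟨hf.sub (continuous_mean hf k), isBounded_iff_forall_norm_le.2 ⟨C, ?_⟩⟩
  rintro _ ⟨t, rfl⟩
  rw [Pi.sub_apply, sub_mean_eq hf hk, norm_neg]
  exact norm_inv_smul_integral_le hk fun s hs => hC s hs t

theorem sub_mean_mem_Cu {f : ℝ → X} (hf : Continuous f) (hd : ∀ h, UniformContinuous (diff h f))
    {k : ℝ} (hk : 0 < k) : f - mean k f ∈ Cu X := by
  refine uniformContinuous_of_forall_le fun ε hε => ?_
  obtain ⟨δ, hδ, h⟩ := exists_modulus_diff hf hd k hε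
  refine ⟨δ, hδ, fun s hs t => ?_⟩
  have hint (u : ℝ) : IntervalIntegrable (fun s => diff s f u) volume 0 k :=
    (continuous_diff_step hf u).intervalIntegrable _ _
  rw [Pi.sub_apply, Pi.sub_apply, sub_mean_eq hf hk, sub_mean_eq hf hk, neg_sub_neg, norm_sub_rev,
    ← smul_sub, ← intervalIntegral.integral_sub (hint _) (hint _)]
  exact norm_inv_smul_integral_le hk fun r hr => h r hr s hs t

theorem sub_mean_mem_Crc {f : ℝ → X} (hf : Continuous f)
    (hd : ∀ h, IsCompact (closure (range (diff h f)))) {k : ℝ} (hk : 0 < k) :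
    f - mean k f ∈ Crc X := by
  refine ⟨hf.sub (continuous_mean hf k), ?_⟩
  have h1 := isCompact_closure_range_mean (g := fun t s => diff s f t)
    (isCompact_closure_diff_Icc hf hd k) hk (continuous_diff_step hf) fun t s hs => ⟨s, hs, t, rfl⟩
  have h2 := isCompact_closure_sub (isCompact_singleton (x := (0 : X))).closure h1
  refine h2.of_isClosed_subset isClosed_closure (closure_mono ?_)
  rintro _ ⟨t, rfl⟩
  refine ⟨0, rfl, _, mem_range_self t, ?_⟩
  rw [Pi.sub_apply, sub_mean_eq hf hk]
  exact zero_sub _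

end

/-! ### Continuity from continuity of the differences -/

section

variable {X : Type*} [NormedAddCommGroup X]

theorem integrableOn_Icc_of_locallyIntegrable {f : ℝ → X} (hf : LocallyIntegrable f volume)
    (a b : ℝ) : IntegrableOn f (Icc a b) volume :=
  hf.integrableOn_isCompact isCompact_Icc

/-- Translation is continuous in `L¹` on bounded intervals. -/
theorem eventually_lintegral_diff_le [NormedSpace ℝ X] {f : ℝ → X}
    (hf : LocallyIntegrable f volume) (a : ℝ) {ε : ℝ} (hε : 0 < ε) :
    ∀ᶠ h in 𝓝 (0 : ℝ), ∫⁻ s in Icc 0 1, ‖diff h f (a + s)‖ₑ ≤ ENNReal.ofReal ε := by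
  set g := (Icc (a - 1) (a + 2)).indicator f with hg
  have hgi : Integrable g volume :=
    (integrableOn_Icc_of_locallyIntegrable hf _ _).integrable_indicator measurableSet_Icc
  have hε3 : 0 < ε / 3 := by linarith
  obtain ⟨φ, hφs, hφ, hφc, -⟩ := hgi.exists_hasCompactSupport_lintegral_sub_le
    (ε := ENNReal.ofReal (ε / 3)) (by simpa using hε3)
  obtain ⟨δ, hδ, hφδ⟩ := Metric.uniformContinuous_iff.1
    (hφs.uniformContinuous_of_continuous hφc) (ε / 3) hε3
  filter_upwards [Metric.ball_mem_nhds (0 : ℝ) (lt_min hδ one_pos)] with h hh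
  rw [Metric.mem_ball, dist_zero_right, Real.norm_eq_abs] at hh
  have hh1 := abs_lt.1 (hh.trans_le (min_le_right _ _))
  have hm (c : ℝ) : AEMeasurable (fun s => ‖g (s + c) - φ (s + c)‖ₑ) volume :=
    (((hgi.aestronglyMeasurable.comp_measurePreserving
      (measurePreserving_add_right volume c)).sub
      (hφc.comp (by fun_prop : Continuous fun s => s + c)).aestronglyMeasurable)).enorm
  have htrans (c : ℝ) : ∫⁻ s in Icc 0 1, ‖g (s + c) - φ (s + c)‖ₑ ≤ ENNReal.ofReal (ε / 3) :=
    (setLIntegral_le_lintegral _ _).trans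
      ((lintegral_add_right_eq_self (fun s => ‖g s - φ s‖ₑ) c).trans_le hφ)
  calc ∫⁻ s in Icc 0 1, ‖diff h f (a + s)‖ₑ
      ≤ ∫⁻ s in Icc 0 1, (‖g (s + (a + h)) - φ (s + (a + h))‖ₑ + ENNReal.ofReal (ε / 3) +
          ‖g (s + a) - φ (s + a)‖ₑ) := by
        refine setLIntegral_mono' measurableSet_Icc fun s hs => ?_
        have e1 : f (a + s + h) = g (s + (a + h)) := by
          have h1 : s + (a + h) ∈ Icc (a - 1) (a + 2) :=
            ⟨by linarith [hs.1], by linarith [hs.2]⟩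
          rw [hg, indicator_of_mem h1]
          congr 1
          ring
        have e2 : f (a + s) = g (s + a) := by
          have h1 : s + a ∈ Icc (a - 1) (a + 2) := ⟨by linarith [hs.1], by linarith [hs.2]⟩
          rw [hg, indicator_of_mem h1, add_comm]
        have e3 : diff h f (a + s) = (g (s + (a + h)) - φ (s + (a + h))) +
            (φ (s + (a + h)) - φ (s + a)) - (g (s + a) - φ (s + a)) := by
          simp only [diff, e1, e2]
          abel
        have e4 : ‖φ (s + (a + h)) - φ (s + a)‖ₑ ≤ ENNReal.ofReal (ε / 3) := by
          rw [← ofReal_norm]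
          refine ENNReal.ofReal_le_ofReal ?_
          rw [← dist_eq_norm]
          refine (hφδ ?_).le
          rw [Real.dist_eq, ← add_assoc, add_sub_cancel_left]
          exact hh.trans_le (min_le_left _ _)
        rw [e3]
        refine enorm_sub_le.trans (add_le_add ((enorm_add_le _ _).trans ?_) le_rfl)
        gcongr
    _ = (∫⁻ s in Icc 0 1, ‖g (s + (a + h)) - φ (s + (a + h))‖ₑ) + ENNReal.ofReal (ε / 3) +
          ∫⁻ s in Icc 0 1, ‖g (s + a) - φ (s + a)‖ₑ := by
        rw [lintegral_add_right' _ (hm a).restrict, lintegral_add_right _ measurable_const]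
        simp
    _ ≤ ENNReal.ofReal (ε / 3) + ENNReal.ofReal (ε / 3) + ENNReal.ofReal (ε / 3) := by
        gcongr <;> exact htrans _
    _ = ENNReal.ofReal ε := by
        rw [← ENNReal.ofReal_add hε3.le hε3.le, ← ENNReal.ofReal_add (by linarith) hε3.le]
        congr 1
        ring

/-- A locally integrable function with continuous differences is continuous. At a discontinuity
`a` the differences `Δ_h f` would stay large at `a` for some `h → 0`, hence at all points
`a + s`, against the continuity of translation in `L¹`. -/
theorem continuous_of_diff [NormedSpace ℝ X] {f : ℝ → X} (hf : LocallyIntegrable f volume)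
    (hd : ∀ h, Continuous (diff h f)) : Continuous f := by
  refine continuous_iff_continuousAt.2 fun a => ?_
  by_contra hna
  obtain ⟨ε, hε, hfreq⟩ : ∃ ε : ℝ, 0 < ε ∧ ∃ᶠ h in 𝓝 (0 : ℝ), ε ≤ ‖diff h f a‖ := by
    by_contra! hall
    refine hna (Metric.tendsto_nhds.2 fun ε hε => ?_)
    have h1 : Tendsto (fun x => x - a) (𝓝 a) (𝓝 0) := by
      simpa using (by fun_prop : Continuous fun x : ℝ => x - a).tendsto a
    have h2 := hall ε hε
    filter_upwards [h1.eventually h2] with x hx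
    simpa [diff, dist_eq_norm] using hx
  let l : Filter ℝ := 𝓝 0 ⊓ 𝓟 {h | ε ≤ ‖diff h f a‖}
  have hl : l.NeBot := Filter.inf_principal_neBot_iff.2 fun U hU =>
    (hfreq.and_eventually hU).exists.imp fun h hh => ⟨hh.2, hh.1⟩
  have hlow (s : ℝ) : ENNReal.ofReal (ε / 2) ≤ liminf (fun h => ‖diff h f (a + s)‖ₑ) l := by
    refine le_liminf_of_le (by isBoundedDefault) ?_
    have h1 : Tendsto (fun h => diff s f (a + h) - diff s f a) (𝓝 0) (𝓝 0) := by
      have := ((hd s).comp (by fun_prop : Continuous fun h : ℝ => a + h)).tendsto 0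
      simpa using this.sub_const (diff s f a)
    have h2 := Metric.tendsto_nhds.1 h1 (ε / 2) (half_pos hε)
    filter_upwards [mem_inf_of_left h2, mem_inf_of_right (mem_principal_self _)] with h hh hh'
    rw [diff_diff_comm, dist_zero_right] at hh
    rw [← ofReal_norm]
    refine ENNReal.ofReal_le_ofReal ?_
    have h3 := norm_sub_norm_le (diff h f a) (diff h f (a + s))
    rw [norm_sub_rev] at h3
    have hh'' : ε ≤ ‖diff h f a‖ := hh'
    linarith
  have h1 : ENNReal.ofReal (ε / 2) ≤ ENNReal.ofReal (ε / 3) := by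
    calc ENNReal.ofReal (ε / 2) = ∫⁻ s in Icc (0 : ℝ) 1, ENNReal.ofReal (ε / 2) := by simp
      _ ≤ ∫⁻ s in Icc (0 : ℝ) 1, liminf (fun h => ‖diff h f (a + s)‖ₑ) l :=
          lintegral_mono fun s => hlow s
      _ ≤ liminf (fun h => ∫⁻ s in Icc (0 : ℝ) 1, ‖diff h f (a + s)‖ₑ) l :=
          lintegral_liminf_le fun h =>
            ((hd h).comp (by fun_prop : Continuous fun s : ℝ => a + s)).enorm.measurable
      _ ≤ ENNReal.ofReal (ε / 3) := by
          refine liminf_le_of_frequently_le' (Eventually.frequently ?_)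
          exact mem_inf_of_left (eventually_lintegral_diff_le hf a (by linarith))
  rw [ENNReal.ofReal_le_ofReal_iff (by linarith)] at h1
  linarith

end

/-! ### The filter of joint periods -/

section

variable {X : Type*} [NormedAddCommGroup X]

/-- The filter generated by the sets of joint `ε`-`K`-periods of finitely many members of `A`. -/
def jointPeriods (A : Set (ℝ → X)) : Filter ℝ where
  sets := {S | ∃ T : Set (ℝ → X), T.Finite ∧ T ⊆ A ∧ ∃ K : Set ℝ, IsCompact K ∧ ∃ ε : ℝ, 0 < ε ∧
    ∀ τ, (∀ f ∈ T, τ ∈ periods f ε K) → τ ∈ S}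
  univ_sets := ⟨∅, finite_empty, empty_subset _, ∅, isCompact_empty, 1, one_pos, fun _ _ => trivial⟩
  sets_of_superset := by
    rintro S S' ⟨T, hT, hTA, K, hK, ε, hε, h⟩ hS
    exact ⟨T, hT, hTA, K, hK, ε, hε, fun τ hτ => hS (h τ hτ)⟩
  inter_sets := by
    rintro S S' ⟨T, hT, hTA, K, hK, ε, hε, h⟩ ⟨T', hT', hTA', K', hK', ε', hε', h'⟩
    refine ⟨T ∪ T', hT.union hT', union_subset hTA hTA', K ∪ K', hK.union hK', min ε ε',
      lt_min hε hε', fun τ hτ => ⟨h τ fun f hf t ht => ?_, h' τ fun f hf t ht => ?_⟩⟩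
    · exact (hτ f (Or.inl hf) t (Or.inl ht)).trans (min_le_left _ _)
    · exact (hτ f (Or.inr hf) t (Or.inr ht)).trans (min_le_right _ _)

theorem recAlong_jointPeriods {A : Set (ℝ → X)} {f : ℝ → X} (hf : f ∈ A) :
    RecAlong (jointPeriods A) f := fun K hK ε hε =>
  ⟨{f}, finite_singleton f, singleton_subset_iff.2 hf, K, hK, ε, hε, fun _ hτ => hτ f rfl⟩

theorem relDense_of_mem_jointPeriods {A : Set (ℝ → X)} (hA : JointlyRecurrent A) {S : Set ℝ}
    (hS : S ∈ jointPeriods A) : RelDense S := by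
  obtain ⟨T, hT, hTA, K, hK, ε, hε, h⟩ := hS
  obtain ⟨n, f, rfl⟩ := hT.fin_embedding
  rcases Nat.eq_zero_or_pos n with rfl | hn
  · refine ⟨{0}, isCompact_singleton, eq_univ_of_forall fun t => ⟨t, h t ?_, 0, rfl, add_zero t⟩⟩
    rintro _ ⟨i, -⟩
    exact i.elim0
  · obtain ⟨L, hL, hEL⟩ := (hA n f hn fun i => hTA (mem_range_self i)).2 K hK ε hε
    refine ⟨L, hL, eq_univ_of_univ_subset (hEL ▸ add_subset_add_right fun τ hτ => h τ ?_)⟩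
    rintro _ ⟨i, rfl⟩ t ht
    exact (norm_le_pi_norm (fun i => f i (t + τ) - f i t) i).trans (hτ t ht)

/-- Functions that are recurrent along the filter of joint periods are jointly recurrent. -/
theorem jointlyRecurrent_of_recAlong {A U : Set (ℝ → X)} (hA : JointlyRecurrent A)
    (hU : ∀ f ∈ U, Continuous f ∧ RecAlong (jointPeriods A) f) : JointlyRecurrent U := by
  intro n f _ hf
  refine ⟨continuous_pi fun i => (hU _ (hf i)).1, fun K hK ε hε => ?_⟩
  refine relDense_of_mem_jointPeriods hA ?_
  filter_upwards [eventually_all.2 fun i => (hU _ (hf i)).2 K hK ε hε] with τ hτ t ht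
  exact (pi_norm_le_iff_of_nonneg hε.le).2 fun i => hτ i t ht

theorem isRecurrent_of_recAlong {A : Set (ℝ → X)} (hA : JointlyRecurrent A) {f : ℝ → X}
    (hfc : Continuous f) (hf : RecAlong (jointPeriods A) f) : IsRecurrent f :=
  ⟨hfc, fun K hK ε hε => relDense_of_mem_jointPeriods hA (hf K hK ε hε)⟩

end

/-! ### Stability properties of the spaces `C_xy` -/

section

variable {𝕜 : Type*} [RCLike 𝕜] {X : Type*} [NormedAddCommGroup X] [NormedSpace 𝕜 X]
  {xy : Idx} {f g : ℝ → X}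

theorem continuous_of_mem_Cxy (hf : f ∈ Cxy 𝕜 X xy) : Continuous f := by
  cases xy
  · exact hf
  · exact hf.1
  · exact UniformContinuous.continuous hf
  · exact hf.1
  · exact hf.1
  · exact UniformContinuous.continuous hf.1
  · exact UniformContinuous.continuous hf.1

theorem range_sub_subset (f g : ℝ → X) : (range fun t => f t - g t) ⊆ range f - range g := by
  rintro _ ⟨t, rfl⟩
  exact sub_mem_sub (mem_range_self t) (mem_range_self t)

theorem sub_mem_Cxy (hf : f ∈ Cxy 𝕜 X xy) (hg : g ∈ Cxy 𝕜 X xy) :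
    (fun t => f t - g t) ∈ Cxy 𝕜 X xy := by
  have hu : f ∈ Cu X → g ∈ Cu X → (fun t => f t - g t) ∈ Cu X := fun hf hg =>
    UniformContinuous.sub hf hg
  have hrwc : f ∈ Crwc 𝕜 X → g ∈ Crwc 𝕜 X → (fun t => f t - g t) ∈ Crwc 𝕜 X := fun hf hg =>
    ⟨hf.1.sub hg.1, (hf.2.sub hg.2).mono (range_sub_subset f g)⟩
  have hrc : f ∈ Crc X → g ∈ Crc X → (fun t => f t - g t) ∈ Crc X := fun hf hg =>
    ⟨hf.1.sub hg.1, (isCompact_closure_sub hf.2 hg.2).of_isClosed_subset isClosed_closure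
      (closure_mono (range_sub_subset f g))⟩
  cases xy
  · exact Continuous.sub hf hg
  · exact ⟨hf.1.sub hg.1, (hf.2.sub hg.2).subset (range_sub_subset f g)⟩
  · exact hu hf hg
  · exact hrwc hf hg
  · exact hrc hf hg
  · exact ⟨hu hf.1 hg.1, hrwc hf.2 hg.2⟩
  · exact ⟨hu hf.1 hg.1, hrc hf.2 hg.2⟩

theorem comp_add_mem_Cxy (hf : f ∈ Cxy 𝕜 X xy) (s : ℝ) : (fun t => f (t + s)) ∈ Cxy 𝕜 X xy := by
  have hc : Continuous fun t : ℝ => t + s := by fun_prop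
  have hr : (range fun t => f (t + s)) ⊆ range f := range_comp_subset_range (· + s) f
  have hu : f ∈ Cu X → (fun t => f (t + s)) ∈ Cu X := fun hf =>
    UniformContinuous.comp hf (uniformContinuous_id.add uniformContinuous_const)
  have hrwc : f ∈ Crwc 𝕜 X → (fun t => f (t + s)) ∈ Crwc 𝕜 X := fun hf =>
    ⟨hf.1.comp hc, hf.2.mono hr⟩
  have hrc : f ∈ Crc X → (fun t => f (t + s)) ∈ Crc X := fun hf =>
    ⟨hf.1.comp hc, hf.2.of_isClosed_subset isClosed_closure (closure_mono hr)⟩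
  cases xy
  · exact Continuous.comp hf hc
  · exact ⟨hf.1.comp hc, hf.2.subset hr⟩
  · exact hu hf
  · exact hrwc hf
  · exact hrc hf
  · exact ⟨hu hf.1, hrwc hf.2⟩
  · exact ⟨hu hf.1, hrc hf.2⟩

/-- If the positive differences lie in `C_xy`, so do all differences. -/
theorem diff_mem_Cxy (hd : ∀ h : ℝ, 0 < h → diff h f ∈ Cxy 𝕜 X xy) (h : ℝ) :
    diff h f ∈ Cxy 𝕜 X xy := by
  have h0 : (fun _ => 0 : ℝ → X) ∈ Cxy 𝕜 X xy := by
    simpa using sub_mem_Cxy (hd 1 one_pos) (hd 1 one_pos)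
  rcases lt_trichotomy h 0 with hh | rfl | hh
  · convert sub_mem_Cxy h0 (comp_add_mem_Cxy (hd (-h) (by linarith)) h) using 1
    ext t
    simp [diff]
  · convert h0 using 1
    ext t
    simp [diff]
  · exact hd h hh

variable [NormedSpace ℝ X] [IsScalarTower ℝ 𝕜 X]

theorem const_smul_mem_Cxy (hf : f ∈ Cxy 𝕜 X xy) (c : ℝ) : (fun t => c • f t) ∈ Cxy 𝕜 X xy := by
  have hr : (range fun t => c • f t) = (fun x => c • x) '' range f := by
    rw [← range_comp]; rfl
  have hu : f ∈ Cu X → (fun t => c • f t) ∈ Cu X := fun hf => UniformContinuous.const_smul hf c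
  have hrwc : f ∈ Crwc 𝕜 X → (fun t => c • f t) ∈ Crwc 𝕜 X := fun hf =>
    ⟨hf.1.const_smul c, (hf.2.smul (c : 𝕜)).mono (by
      rintro _ ⟨t, rfl⟩
      exact ⟨f t, mem_range_self t, (RCLike.real_smul_eq_coe_smul c (f t)).symm⟩)⟩
  have hrc : f ∈ Crc X → (fun t => c • f t) ∈ Crc X := fun hf =>
    ⟨hf.1.const_smul c, (hf.2.image (continuous_const_smul c)).closure_of_subset
      (by rw [hr]; exact image_mono subset_closure)⟩
  cases xy
  · exact Continuous.const_smul hf c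
  · refine ⟨hf.1.const_smul c, ?_⟩
    rw [hr]
    exact (lipschitzWith_smul c).isBounded_image hf.2
  · exact hu hf
  · exact hrwc hf
  · exact hrc hf
  · exact ⟨hu hf.1, hrwc hf.2⟩
  · exact ⟨hu hf.1, hrc hf.2⟩

variable [CompleteSpace X]

theorem mean_mem_Cxy (hf : f ∈ Cxy 𝕜 X xy) {k : ℝ} (hk : 0 < k) : mean k f ∈ Cxy 𝕜 X xy := by
  have hu : f ∈ Cu X → mean k f ∈ Cu X := fun hf =>
    uniformContinuous_of_forall_le fun ε hε => by
      obtain ⟨δ, hδ, h⟩ := exists_forall_le_of_uniformContinuous hf hε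
      exact ⟨δ, hδ, fun s hs t => norm_mean_shift_sub_le (UniformContinuous.continuous hf) hk
        fun r _ => h s hs (t + r)⟩
  have hrwc : f ∈ Crwc 𝕜 X → mean k f ∈ Crwc 𝕜 X := fun hf =>
    ⟨continuous_mean hf.1 k, ((hf.2.range_integral hf.1 hk).smul ((k⁻¹ : ℝ) : 𝕜)).mono (by
      rintro _ ⟨t, rfl⟩
      exact ⟨_, mem_range_self t, (RCLike.real_smul_eq_coe_smul k⁻¹ _).symm⟩)⟩
  have hrc : f ∈ Crc X → mean k f ∈ Crc X := fun hf =>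
    ⟨continuous_mean hf.1 k, isCompact_closure_range_mean (g := fun t s => f (t + s)) hf.2 hk
      (fun t => hf.1.comp (continuous_const.add continuous_id)) fun t s _ => mem_range_self _⟩
  cases xy
  · exact continuous_mean hf k
  · refine ⟨continuous_mean hf.1 k, ?_⟩
    obtain ⟨B, hB⟩ := hf.2.exists_norm_le
    refine isBounded_iff_forall_norm_le.2 ⟨B, ?_⟩
    rintro _ ⟨t, rfl⟩
    exact norm_inv_smul_integral_le hk fun s _ => hB _ (mem_range_self (t + s))
  · exact hu hf
  · exact hrwc hf
  · exact hrc hf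
  · exact ⟨hu hf.1, hrwc hf.2⟩
  · exact ⟨hu hf.1, hrc hf.2⟩

end

/-! ### Maximal classes of jointly recurrent functions -/

section

variable {𝕜 : Type*} [RCLike 𝕜] {X : Type*} [NormedAddCommGroup X] [NormedSpace 𝕜 X]
  {xy : Idx} {V A : Set (ℝ → X)} {F : ℝ → X}

theorem range_rwc_of_diff [CompleteSpace X] (hF : IsRecurrent F)
    (hd : ∀ h : ℝ, 0 < h → diff h F ∈ Crwc 𝕜 X) : F ∈ Crwc 𝕜 X :=
  ⟨hF.1, hF.range_of_diff (P := RelWeaklyCompact 𝕜)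
    (fun _ => relWeaklyCompact_of_isCompact isCompact_singleton) .sub .biUnion_finset .mono
    .of_approx fun h hh => (hd h hh).2⟩

theorem range_rc_of_diff [CompleteSpace X] (hF : IsRecurrent F)
    (hd : ∀ h : ℝ, 0 < h → diff h F ∈ Crc X) : F ∈ Crc X :=
  ⟨hF.1, hF.range_of_diff (P := fun M => IsCompact (closure M))
    (fun _ => isCompact_singleton.closure) isCompact_closure_sub isCompact_closure_biUnion
    (fun hN h => hN.of_isClosed_subset isClosed_closure (closure_mono h))
    isCompact_closure_of_approx fun h hh => (hd h hh).2⟩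

theorem mem_Cxy_of_diff [NormedSpace ℝ X] [CompleteSpace X] (hFb : F ∈ Cb X) (hF : IsRecurrent F)
    (hd : ∀ h : ℝ, 0 < h → diff h F ∈ Cxy 𝕜 X xy) : F ∈ Cxy 𝕜 X xy := by
  have hd' := diff_mem_Cxy hd
  cases xy
  · exact hF.1
  · exact hFb
  · exact uniformContinuous_of_diff hFb hd'
  · exact range_rwc_of_diff hF hd
  · exact range_rc_of_diff hF hd
  · exact ⟨uniformContinuous_of_diff hFb fun h => (hd' h).1,
      range_rwc_of_diff hF fun h hh => (hd h hh).2⟩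
  · exact ⟨uniformContinuous_of_diff hFb fun h => (hd' h).1,
      range_rc_of_diff hF fun h hh => (hd h hh).2⟩

/-- By maximality, a class `rec_xy V` contains every function of `C_xy` that is recurrent along the
filter of its joint periods. -/
theorem IsRecClass.mem_of_recAlong (hA : IsRecClass 𝕜 xy V A) (hF : F ∈ Cxy 𝕜 X xy)
    (hr : RecAlong (jointPeriods A) F) : F ∈ A := by
  have hFc := continuous_of_mem_Cxy hF
  have hAJ := hA.prop.2.2
  refine hA.le_of_ge (y := insert F A) ⟨insert_subset
    ⟨isRecurrent_of_recAlong hAJ hFc hr, hF⟩ hA.prop.1, hA.prop.2.1.trans (subset_insert _ _), ?_⟩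
    (subset_insert _ _) (mem_insert _ _)
  refine jointlyRecurrent_of_recAlong hAJ ?_
  rintro f (rfl | hf)
  · exact ⟨hFc, hr⟩
  · exact ⟨continuous_of_mem_Cxy (hA.prop.1 hf).2, recAlong_jointPeriods hf⟩

theorem IsRecClass.continuous (hA : IsRecClass 𝕜 xy V A) (hF : F ∈ A) : Continuous F :=
  continuous_of_mem_Cxy (hA.prop.1 hF).2

variable [NormedSpace ℝ X] [IsScalarTower ℝ 𝕜 X] [CompleteSpace X]

/-- A bounded function whose differences lie in `C_xy` and are recurrent along the joint periods of
`rec_xy V` belongs to `rec_xy V`, given the hypothesis of the Loomis–Kadets theorem. -/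
theorem IsRecClass.mem_of_diff (hA : IsRecClass 𝕜 xy V A) (hF : F ∈ Cb X)
    (hX : ¬ ContainsC0 𝕜 X ∨ RelWeaklySeqComplete 𝕜 (range F))
    (hd : ∀ h : ℝ, 0 < h → diff h F ∈ Cxy 𝕜 X xy)
    (hr : ∀ h : ℝ, 0 < h → RecAlong (jointPeriods A) (diff h F)) : F ∈ A := by
  have hFr := recAlong_of_diff hF hX hr
  exact hA.mem_of_recAlong
    (mem_Cxy_of_diff hF (isRecurrent_of_recAlong hA.prop.2.2 hF.1 hFr) hd) hFr

theorem IsRecClass.satL (hA : IsRecClass 𝕜 xy V A) {U : Set (ℝ → X)}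
    (hU : ∀ F ∈ U, F ∈ Cb X ∧ (¬ ContainsC0 𝕜 X ∨ RelWeaklySeqComplete 𝕜 (range F))) :
    SatL U A := fun F hF hd =>
  hA.mem_of_diff (hU F hF).1 (hU F hF).2 (fun h hh => (hA.prop.1 (hd h hh)).2)
    fun h hh => recAlong_jointPeriods (hd h hh)

theorem IsRecClass.satP (hA : IsRecClass 𝕜 xy V A) {U : Set (ℝ → X)}
    (hU : ∀ F ∈ U, F ∈ Cb X ∧ (¬ ContainsC0 𝕜 X ∨ RelWeaklySeqComplete 𝕜 (range F))) :
    SatP U A := fun f hf hP => by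
  have hfc := hA.continuous hf
  refine hA.mem_of_diff (hU _ hP).1 (hU _ hP).2 (fun h hh => ?_) fun h hh => ?_
  · rw [diff_prim hfc hh]
    exact const_smul_mem_Cxy (mean_mem_Cxy (hA.prop.1 hf).2 hh) h
  · rw [diff_prim hfc hh]
    exact ((recAlong_jointPeriods hf).mean hfc hh).const_smul h

theorem IsRecClass.satDelta (hA : IsRecClass 𝕜 xy V A) (hxy : xy ≠ .none)
    (hX : xy = .b ∨ xy = .rwc → ¬ ContainsC0 𝕜 X) : SatDelta A := by
  intro f hf hd k hk
  have hdC := diff_mem_Cxy fun h hh => (hA.prop.1 (hd h hh)).2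
  have hdr := recAlong_diff_of_pos fun h hh => recAlong_jointPeriods (hd h hh)
  have hfc : Continuous f := continuous_of_diff hf fun h => continuous_of_mem_Cxy (hdC h)
  have hDd (h : ℝ) : diff h (f - mean k f) ∈ Cxy 𝕜 X xy := by
    rw [diff_sub_mean hfc]
    exact sub_mem_Cxy (hdC h) (mean_mem_Cxy (hdC h) hk)
  have hDr (h : ℝ) : RecAlong (jointPeriods A) (diff h (f - mean k f)) := by
    rw [diff_sub_mean hfc]
    exact (hdr h).sub ((hdr h).mean (continuous_diff hfc h) hk)
  have hbdd (hb : ∀ h, Bornology.IsBounded (range (diff h f))) (hc : ¬ ContainsC0 𝕜 X) :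
      f - mean k f ∈ A :=
    hA.mem_of_diff (sub_mean_mem_Cb hfc hb hk) (Or.inl hc) (fun h _ => hDd h) fun h _ => hDr h
  -- functions with relatively compact range fall under the second alternative
  have hcompact (hc : ∀ h, IsCompact (closure (range (diff h f)))) : f - mean k f ∈ A := by
    have h1 := sub_mean_mem_Crc hfc hc hk
    exact hA.mem_of_diff ⟨h1.1, h1.2.isBounded.subset subset_closure⟩
      (Or.inr (relWeaklySeqComplete_of_isCompact_closure h1.2)) (fun h _ => hDd h) fun h _ => hDr h
  cases xy
  · exact absurd rfl hxy
  · exact hbdd (fun h => (hdC h).2) (hX (Or.inl rfl))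
  · exact hA.mem_of_recAlong (sub_mean_mem_Cu hfc hdC hk) (recAlong_sub_mean hfc hdC hdr hk)
  · exact hbdd (fun h => (hdC h).2.isBounded) (hX (Or.inr rfl))
  · exact hcompact fun h => (hdC h).2
  · have hr := recAlong_sub_mean hfc (fun h => (hdC h).1) hdr hk
    have hrec := isRecurrent_of_recAlong hA.prop.2.2 (hfc.sub (continuous_mean hfc k)) hr
    exact hA.mem_of_recAlong ⟨sub_mean_mem_Cu hfc (fun h => (hdC h).1) hk,
      range_rwc_of_diff hrec fun h _ => (hDd h).2⟩ hr
  · exact hcompact fun h => (hdC h).2.2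

end

end RecFun

theorem corollary4p9 {𝕜 : Type*} [RCLike 𝕜] {X : Type*} [NormedAddCommGroup X]
    [NormedSpace ℝ X] [NormedSpace 𝕜 X] [IsScalarTower ℝ 𝕜 X] [CompleteSpace X]
    (xy : RecFun.Idx) (V A : Set (ℝ → X)) (hne : V.Nonempty)
    (hV : V ⊆ RecFun.REC 𝕜 X xy) (hV2 : RecFun.JointlyRecurrent V)
    (hA : RecFun.IsRecClass 𝕜 xy V A) :
    (¬ RecFun.ContainsC0 𝕜 X →
      RecFun.SatL (RecFun.Cb X) A ∧ RecFun.SatP (RecFun.Cb X) A) ∧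
    (RecFun.SatL (RecFun.Cbwscp 𝕜 X) A ∧ RecFun.SatP (RecFun.Cbwscp 𝕜 X) A) ∧
    (xy ≠ RecFun.Idx.none →
      (xy = RecFun.Idx.b ∨ xy = RecFun.Idx.rwc → ¬ RecFun.ContainsC0 𝕜 X) →
      RecFun.SatDelta A) := by
  refine ⟨fun hX => ⟨hA.satL fun F hF => ⟨hF, Or.inl hX⟩, hA.satP fun F hF => ⟨hF, Or.inl hX⟩⟩,
    ⟨hA.satL fun F hF => ⟨hF.1, Or.inr hF.2⟩, hA.satP fun F hF => ⟨hF.1, Or.inr hF.2⟩⟩,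
    hA.satDelta⟩
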